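/- **Theorem 4.3 (Systematic-row approximation).** Let $d=3$, $\Lambda^*=\mathbb Z^3$ and $\nu=(0,0,1)$. For $k_0\in\mathbb R^3$ and $g\in\Lambda^*$ put $\rho_g=(k_0+g)\cdot\nu$ and $\sigma_g=|k_0|^2-|k_0+g|^2$. Let $U=(U_g)_{g\in\Lambda^*}$ be complex numbers with $U_{-g}=\overline{U_g}$ and $|U_g|\le C_{\mathbb U}e^{-\alpha_{\mathbb U}|g|}$ for all $g$, where $C_{\mathbb U},\alpha_{\mathbb U}>0$. For a set $G\subset\Lambda^*$ with $0\in G$ and $\rho_g>0$ on $G$ let $\|A\|_G=\big(\sum_{g\in G}\rho_g|A_g|^2\big)^{1/2}$ and $\mathfrak H(G)=\{A\in\ell^2(G):\|A\|_G<\infty\}$. A solution of $\mathrm{DHW}_G$ is a function $\psi\in C^0(\mathbb R;\mathfrak H(G))$ with differentiable components, with $\psi(0)=\delta:=(\delta_{0,g})_{g}$ and $$ i\,\frac{\rho_g}{\pi}\,\dot\psi_g+\sigma_g\psi_g=-\sum_{h\in G}U_{g-h}\psi_h\qquad\text{on }\mathbb R\text{, for all } g\in G. $$ Let $G_{\gamma}=\{g\in\Lambda^*:\rho_g\ge\gamma\rho_0\}$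 with $\gamma=1/2$, and let $G_{\mathrm{syrow}}=\{(0,n,0): n\in\mathbb Z,\ |n|\le|k_0|^{1/4}\}$. Fix $c_*>0$, $\alpha_{\mathbb U}>0$ and a length scale $\alpha_*>0$. Then for every $N_0\in\mathbb R$ there exist $k_*>0$ and $N_1>0$, depending only on $c_*,\alpha_{\mathbb U},\alpha_*,N_0$, such that for every $C_{\mathbb U}>0$, every $U$ as above and every $k_0=(c_*|k_0|^{2/3},0,k_z)$ with $k_z>0$ and $|k_0|\ge k_*$ the following holds. The systems $\mathrm{DHW}_{G_\gamma}$ and $\mathrm{DHW}_{G_{\mathrm{syrow}}}$ have unique solutions $\psi^\gamma$ and $\psi_{\mathrm{syrow}}$, and if $$ z_*\le N_0\,|\alpha_*k_0|^{1/5}\,\frac{|k_0|}{C_{\mathbb U}}, $$ then for all $z\in[0,z_*]$ $$ \big\|\psi_{\mathrm{syrow}}(z)-\psi^\gamma(z)|_{G_{\mathrm{syrow}}}\big\|_{G_{\mathrm{syrow}}}\le N_1\Big(\frac1{|\alpha_*k_0|^2}+\frac{\alpha_*^{3/2}C_{\mathbb U}^2}{|k_0|^{3/2}}\,z_*\Big)\|\delta\|_{G_\gamma}.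 $$ -/

import Mathlib

noncomputable section

namespace DHW

/-- Euclidean three-space, with the coordinates `(x, y, z)` numbered `0, 1, 2`. -/
abbrev E3 : Type := EuclideanSpace ℝ (Fin 3)

/-- Index set of the dual lattice `Λ* = ℤ³`. -/
abbrev DualLattice : Type := Fin 3 → ℤ

/-- The wave vector in `ℝ³` of a point of the dual lattice `ℤ³`. -/
def waveVector (g : DualLattice) : E3 := WithLp.toLp 2 fun i => (g i : ℝ)

/-- The outward normal `ν = (0, 0, 1)` at the exit plane. -/
def normal : E3 := EuclideanSpace.single 2 1

/-- `ρ_g = (k₀ + g) · ν`. -/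
def rho (k₀ : E3) (g : DualLattice) : ℝ := inner ℝ (k₀ + waveVector g) normal

/-- `σ_g = |k₀|² - |k₀ + g|²`. -/
def sigma (k₀ : E3) (g : DualLattice) : ℝ := ‖k₀‖ ^ 2 - ‖k₀ + waveVector g‖ ^ 2

/-- `G_γ = {g ∈ Λ* : ρ_g ≥ γ ρ_0}`. -/
def Ggamma (k₀ : E3) (γ : ℝ) : Set DualLattice := {g | γ * rho k₀ 0 ≤ rho k₀ g}

/-- The systematic row `{(0, n, 0) : |n| ≤ |k₀|^{1/4}}`. -/
def Gsyrow (k₀ : E3) : Set DualLattice :=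
  {g | ∃ n : ℤ, g = ![0, n, 0] ∧ |(n : ℝ)| ≤ ‖k₀‖ ^ (1 / 4 : ℝ)}

/-- The norm `‖A‖_G = (∑_{g ∈ G} ρ_g |A_g|²)^{1/2}`. It only sees the restriction of `A` to `G`. -/
def normOn (k₀ : E3) (G : Set DualLattice) (A : DualLattice → ℂ) : ℝ :=
  √(∑' g : G, rho k₀ g * ‖A g‖ ^ 2)

/-- Membership in the Hilbert space `{A ∈ ℓ²(G) : ‖A‖_G < ∞}`, where amplitude vectors on `G` are
extended by zero to the whole dual lattice. -/
structure MemHilbert (k₀ : E3) (G : Set DualLattice) (A : DualLattice → ℂ) : Prop where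
  eq_zero : ∀ g, g ∉ G → A g = 0
  summable_sq : Summable fun g : G => ‖A g‖ ^ 2
  summable_rho : Summable fun g : G => rho k₀ g * ‖A g‖ ^ 2

/-- The incoming beam `δ = (δ_{0,g})_g`. -/
def delta : DualLattice → ℂ := Pi.single 0 1

/-- `ψ ∈ C⁰(ℝ; 𝓗(G))` solves the Darwin-Howie-Whelan equations on the set `G`,
`i (ρ_g/π) ψ_g' + σ_g ψ_g = - ∑_{h ∈ G} U_{g-h} ψ_h` for all `g ∈ G`, with `ψ(0) = δ`
(and `ψ_h ≡ 0` for `h ∉ G`). -/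
structure IsSolution (k₀ : E3) (U : DualLattice → ℂ) (G : Set DualLattice)
    (ψ : ℝ → DualLattice → ℂ) : Prop where
  mem : ∀ z, MemHilbert k₀ G (ψ z)
  continuous : ∀ z₀, Filter.Tendsto (fun z => normOn k₀ G (ψ z - ψ z₀)) (nhds z₀) (nhds 0)
  differentiable : ∀ g ∈ G, Differentiable ℝ fun z => ψ z g
  equation : ∀ g ∈ G, ∀ z,
    Complex.I * ((rho k₀ g / Real.pi : ℝ) : ℂ) * deriv (fun ζ => ψ ζ g) z
      + (sigma k₀ g : ℂ) * ψ z g = -∑' h : G, U (g - h) * ψ z h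
  initial : ψ 0 = delta

end DHW

end

noncomputable section

namespace DHW

open Filter Topology
open scoped InnerProductSpace

/-! Put φ_g = √ρ_g ψ_g and κ = |k₀|. Then ‖ψ‖_G becomes the ℓ² norm and the system becomes φ' = i(D
+ B)φ, with D the real, unbounded diagonal πσ_g/ρ_g and B the self-adjoint operator with kernel
πU_{g-h}/√(ρ_g ρ_h). Since ρ ≥ κ/4 on both index sets, Schur's test gives ‖B‖ ≤ b = O(C_U/κ). In the
frame rotating with D the generator is bounded, whence existence and uniqueness; symmetry of B keeps
the norm from growing.

The row solution evolves under B compressed to the row. Its distance E to the projected full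
solution is driven only by the off-row part of φ, so E ≤ b·m·z if that part is at most m
(`IsTrajectory.norm_sub_proj_le`). With q = κ^{1/4} and A = ‖δ‖, the off-row modes are of two kinds.

Far modes, |g| > q: an exponentially weighted norm bounds them by e^{bz - aq}A
(`IsTrajectory.norm_proj_far_le`). The restriction on z_* makes bz = O(κ^{1/5}), so this beats every
power of κ.

Near modes, |g| ≤ q: k₀ is orthogonal to the row, so there σ_g = -|g|² and D = O(κ^{-1/2}); off the
row |σ_g| ≥ c_*κ^{2/3}, so |D| ≥ Δ of order κ^{-1/3}. A Riccati equation provides an operator X of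
norm at most x = 2b/Δ whose graph is invariant up to leakage into the far modes. The near amplitude
is Xφ plus a remainder that starts at O(xA) and grows at rate only xb
(`IsTrajectory.norm_proj_le_of_gap`).

The near modes thus contribute O(xbz), where xbz = O(C_U² z κ^{-5/3}), better than the required
κ^{-3/2}. The gap argument needs b small against Δ, which holds for C_U ≤ κ^{1/2}; otherwise E ≤ bAz
already suffices, and E ≤ 2A suffices once C_U² z ≥ κ^{3/2}. Hence no constant depends on C_U. -/

/-- The Hilbert space `ℓ²(ι)`. -/
abbrev L2 (ι : Type*) : Type _ := lp (fun _ : ι => ℂ) 2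

/-! ### Diagonal, shift and convolution-type operators on ℓ². -/

section Operators

variable {ι : Type*}

theorem hasSum_norm_sq (f : L2 ι) : HasSum (fun i => ‖f i‖ ^ 2) (‖f‖ ^ 2) := by
  have h := lp.hasSum_norm (p := 2) (by norm_num) f
  simpa using h

theorem memℓp_two_iff {f : ι → ℂ} : Memℓp f 2 ↔ Summable fun i => ‖f i‖ ^ 2 := by
  rw [memℓp_gen_iff (by norm_num)]
  simp

theorem norm_le_of_forall_norm_le {f g : L2 ι} {C : ℝ} (hC : 0 ≤ C)
    (h : ∀ i, ‖f i‖ ≤ C * ‖g i‖) : ‖f‖ ≤ C * ‖g‖ := by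
  have h2 : ‖f‖ ^ 2 ≤ C ^ 2 * ‖g‖ ^ 2 := by
    refine hasSum_le (fun i => ?_) (hasSum_norm_sq f) ((hasSum_norm_sq g).mul_left (C ^ 2))
    rw [← mul_pow]
    exact pow_le_pow_left₀ (norm_nonneg _) (h i) 2
  rw [← mul_pow] at h2
  exact le_of_sq_le_sq h2 (by positivity)

theorem norm_sq_mul_le {m : ι → ℂ} {C : ℝ} (hm : ∀ i, ‖m i‖ ≤ C) (a : ℂ) (i : ι) :
    ‖m i * a‖ ^ 2 ≤ C ^ 2 * ‖a‖ ^ 2 := by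
  rw [norm_mul, mul_pow]
  have := hm i
  gcongr

theorem hasSum_norm_sq_comp (σ : Equiv.Perm ι) (C : ℝ) (f : L2 ι) :
    HasSum (fun i => C ^ 2 * ‖f (σ i)‖ ^ 2) (C ^ 2 * ‖f‖ ^ 2) :=
  ((σ.hasSum_iff (f := fun i => ‖f i‖ ^ 2)).2 (hasSum_norm_sq f)).mul_left _

/-- The linear map underlying `weightedComp`. -/
def weightedCompLinear (m : ι → ℂ) (σ : Equiv.Perm ι) (C : ℝ) (hm : ∀ i, ‖m i‖ ≤ C) :
    L2 ι →ₗ[ℂ] L2 ι where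
  toFun f := ⟨fun i => m i * f (σ i), memℓp_two_iff.2 <|
    Summable.of_nonneg_of_le (fun _ => by positivity) (fun i => norm_sq_mul_le hm _ i)
      (hasSum_norm_sq_comp σ C f).summable⟩
  map_add' f g := by
    ext i
    exact mul_add _ _ _
  map_smul' c f := by
    ext i
    exact mul_left_comm _ _ _

theorem weightedCompLinear_apply (m : ι → ℂ) (σ : Equiv.Perm ι) (C : ℝ) (hm : ∀ i, ‖m i‖ ≤ C)
    (f : L2 ι) (i : ι) : weightedCompLinear m σ C hm f i = m i * f (σ i) := rfl

theorem weightedCompLinear_bound (m : ι → ℂ) (σ : Equiv.Perm ι) (C : ℝ) (hC : 0 ≤ C)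
    (hm : ∀ i, ‖m i‖ ≤ C) (f : L2 ι) : ‖weightedCompLinear m σ C hm f‖ ≤ C * ‖f‖ := by
  have h : ‖weightedCompLinear m σ C hm f‖ ^ 2 ≤ C ^ 2 * ‖f‖ ^ 2 := by
    refine hasSum_le (fun i => ?_) (hasSum_norm_sq (weightedCompLinear m σ C hm f))
      (hasSum_norm_sq_comp σ C f)
    rw [weightedCompLinear_apply]
    exact norm_sq_mul_le hm _ i
  rw [← mul_pow] at h
  exact le_of_sq_le_sq h (mul_nonneg hC (norm_nonneg f))

/-- The weighted composition operator `f ↦ (i ↦ m i * f (σ i))`. -/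
def weightedComp (m : ι → ℂ) (σ : Equiv.Perm ι) (C : ℝ) (hC : 0 ≤ C) (hm : ∀ i, ‖m i‖ ≤ C) :
    L2 ι →L[ℂ] L2 ι :=
  (weightedCompLinear m σ C hm).mkContinuous C (weightedCompLinear_bound m σ C hC hm)

@[simp]
theorem weightedComp_apply (m : ι → ℂ) (σ : Equiv.Perm ι) (C : ℝ) (hC : 0 ≤ C)
    (hm : ∀ i, ‖m i‖ ≤ C) (f : L2 ι) (i : ι) :
    weightedComp m σ C hC hm f i = m i * f (σ i) := rfl

theorem norm_weightedComp_le (m : ι → ℂ) (σ : Equiv.Perm ι) (C : ℝ) (hC : 0 ≤ C)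
    (hm : ∀ i, ‖m i‖ ≤ C) : ‖weightedComp m σ C hC hm‖ ≤ C :=
  LinearMap.mkContinuous_norm_le _ hC _

/-- The diagonal operator with bounded symbol `m`. -/
def diag (m : ι → ℂ) (C : ℝ) (hC : 0 ≤ C) (hm : ∀ i, ‖m i‖ ≤ C) : L2 ι →L[ℂ] L2 ι :=
  weightedComp m (Equiv.refl ι) C hC hm

@[simp]
theorem diag_apply (m : ι → ℂ) (C : ℝ) (hC : 0 ≤ C) (hm : ∀ i, ‖m i‖ ≤ C) (f : L2 ι) (i : ι) :
    diag m C hC hm f i = m i * f i := rfl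

theorem norm_diag_le (m : ι → ℂ) (C : ℝ) (hC : 0 ≤ C) (hm : ∀ i, ‖m i‖ ≤ C) :
    ‖diag m C hC hm‖ ≤ C :=
  norm_weightedComp_le _ _ _ _ _

/-- The orthogonal projection of `ℓ²(ι)` onto the sequences supported in `s`. -/
def proj (s : Set ι) : L2 ι →L[ℂ] L2 ι :=
  diag (s.indicator 1) 1 zero_le_one fun i => by
    classical
    rw [Set.indicator_apply]
    split_ifs <;> simp

theorem proj_apply_of_mem {s : Set ι} {i : ι} (hi : i ∈ s) (f : L2 ι) : proj s f i = f i := by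
  simp [proj, hi]

theorem proj_apply_of_notMem {s : Set ι} {i : ι} (hi : i ∉ s) (f : L2 ι) : proj s f i = 0 := by
  simp [proj, hi]

theorem norm_proj_le (s : Set ι) : ‖proj s‖ ≤ 1 := norm_diag_le _ _ _ _

theorem norm_proj_apply_le (s : Set ι) (f : L2 ι) : ‖proj s f‖ ≤ ‖f‖ := by
  simpa using (proj s).le_of_opNorm_le (norm_proj_le s) f

theorem proj_proj (s : Set ι) (f : L2 ι) : proj s (proj s f) = proj s f := by
  ext i
  by_cases hi : i ∈ s
  · simp only [proj_apply_of_mem hi]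
  · simp only [proj_apply_of_notMem hi]

theorem proj_eq_self {s : Set ι} {f : L2 ι} (h : ∀ i, i ∉ s → f i = 0) : proj s f = f := by
  ext i
  by_cases hi : i ∈ s
  · rw [proj_apply_of_mem hi]
  · rw [proj_apply_of_notMem hi, h i hi]

theorem inner_proj_left (s : Set ι) (f g : L2 ι) : ⟪proj s f, g⟫_ℂ = ⟪f, proj s g⟫_ℂ := by
  rw [lp.inner_eq_tsum, lp.inner_eq_tsum]
  refine tsum_congr fun i => ?_
  by_cases hi : i ∈ s
  · simp only [proj_apply_of_mem hi]
  · simp [proj_apply_of_notMem hi]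

/-- Schur's test for kernels dominated by a convolution kernel. -/
theorem exists_kernel_operator [AddCommGroup ι] {K : ι → ι → ℂ} {v : ι → ℝ} (hv : Summable v)
    (hK : ∀ g h, ‖K g h‖ ≤ v (g - h)) :
    ∃ A : L2 ι →L[ℂ] L2 ι, ‖A‖ ≤ ∑' k, v k ∧
      ∀ (f : L2 ι) g, HasSum (fun h => K g h * f h) (A f g) := by
  have hv0 : ∀ k, 0 ≤ v k := fun k => (norm_nonneg _).trans (by simpa using hK k 0)
  -- The kernel is cut into its off-diagonals g - h = k; each is a weighted shift of norm at most v
  -- k, so the series converges in operator norm.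
  let T : ι → L2 ι →L[ℂ] L2 ι := fun k =>
    weightedComp (fun g => K g (g - k)) (Equiv.subRight k) (v k) (hv0 k)
      fun g => by simpa using hK g (g - k)
  have hT : ∀ k, ‖T k‖ ≤ v k := fun k => norm_weightedComp_le _ _ _ _ _
  have hsum : Summable T := Summable.of_norm_bounded hv hT
  refine ⟨∑' k, T k, tsum_of_norm_bounded hv.hasSum hT, fun f g => ?_⟩
  have h1 : HasSum (fun k => T k f) ((∑' k, T k) f) :=
    hsum.hasSum.mapL (ContinuousLinearMap.apply ℂ (L2 ι) f)
  have h2 : HasSum (fun k => T k f g) ((∑' k, T k) f g) :=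
    h1.mapL (lp.evalCLM ℂ (fun _ : ι => ℂ) 2 g)
  rw [← (Equiv.subLeft g).hasSum_iff]
  simpa [Function.comp_def, T] using h2

/-- Pairing the adjoint with a basis vector produces a column of K, conjugated; Hermitian symmetry
turns it into the row that defines A. -/
theorem inner_comm_of_kernel {K : ι → ι → ℂ} (hK : ∀ g h, K h g = star (K g h))
    {A : L2 ι →L[ℂ] L2 ι} (hA : ∀ (f : L2 ι) g, HasSum (fun h => K g h * f h) (A f g))
    (f f' : L2 ι) : ⟪A f, f'⟫_ℂ = ⟪f, A f'⟫_ℂ := by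
  classical
  have hsingle : ∀ g h, A (lp.single 2 g 1) h = K h g := fun g h => by
    refine (hA _ h).unique ?_
    have := hasSum_single (f := fun j => K h j * (lp.single 2 g (1 : ℂ) : L2 ι) j) g
      fun j hj => by rw [lp.single_apply_ne 2 g _ hj, mul_zero]
    simpa using this
  have hadj : ∀ x : L2 ι, ContinuousLinearMap.adjoint A x = A x := fun x => by
    ext g
    have h1 : ContinuousLinearMap.adjoint A x g
        = ⟪(lp.single 2 g (1 : ℂ) : L2 ι), ContinuousLinearMap.adjoint A x⟫_ℂ := by
      rw [lp.inner_single_left]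
      simp
    rw [h1, ContinuousLinearMap.adjoint_inner_right]
    refine (lp.hasSum_inner _ _).unique ?_
    have h2 : (fun h => ⟪A (lp.single 2 g 1) h, x h⟫_ℂ) = fun h => K g h * x h := by
      funext h
      rw [hsingle, hK]
      simp [mul_comm]
    rw [h2]
    exact hA x g
  rw [← hadj f', ContinuousLinearMap.adjoint_inner_right]

end Operators

end DHW
end

noncomputable section

namespace DHW

open Filter Topology MeasureTheory
open scoped InnerProductSpace BoundedContinuousFunction

/-! ### Linear evolution equations with unbounded diagonal part and bounded coupling. -/

section Evolution

theorem norm_intervalIntegral_le_exp {X : Type*} [NormedAddCommGroup X] [NormedSpace ℝ X]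
    {f : ℝ → X} {c L : ℝ} (hc : 0 ≤ c) (hL : 0 < L)
    (h : ∀ s, ‖f s‖ ≤ c * Real.exp (L * |s|)) (t : ℝ) :
    ‖∫ s in (0 : ℝ)..t, f s‖ ≤ c / L * Real.exp (L * |t|) := by
  have key : ∀ (g : ℝ → X), (∀ s, ‖g s‖ ≤ c * Real.exp (L * |s|)) → ∀ r, 0 ≤ r →
      ‖∫ s in (0 : ℝ)..r, g s‖ ≤ c / L * Real.exp (L * |r|) := fun g hg r hr => by
    have hcont : Continuous fun s => c * Real.exp (L * s) := by fun_prop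
    have hd : ∀ s ∈ Set.uIcc 0 r,
        HasDerivAt (fun s => c / L * Real.exp (L * s)) (c * Real.exp (L * s)) s := fun s _ => by
      have h1 := (((hasDerivAt_id s).const_mul L).exp).const_mul (c / L)
      simp only [id] at h1
      refine h1.congr_deriv ?_
      field_simp
    refine (intervalIntegral.norm_integral_le_of_norm_le (g := fun s => c * Real.exp (L * s)) hr
      (ae_of_all _ fun s hs => ?_) (hcont.intervalIntegrable _ _)).trans ?_
    · simpa [abs_of_pos hs.1] using hg s
    · rw [intervalIntegral.integral_eq_sub_of_hasDerivAt hd (hcont.intervalIntegrable _ _),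
        abs_of_nonneg hr]
      simp only [mul_zero, Real.exp_zero, mul_one, tsub_le_iff_right, le_add_iff_nonneg_right]
      positivity
  rcases le_total 0 t with ht | ht
  · exact key f h t ht
  · have h1 : ∫ s in (0 : ℝ)..t, f s = -∫ s in (0 : ℝ)..(-t), f (-s) := by
      rw [intervalIntegral.integral_comp_neg, neg_neg, neg_zero, intervalIntegral.integral_symm]
    rw [h1, norm_neg, ← abs_neg]
    exact key (fun s => f (-s)) (fun s => by simpa using h (-s)) (-t) (by linarith)

/-- Global solvability of linear equations with a bounded strongly continuous generator. -/
theorem exists_forall_hasDerivAt {X : Type*} [NormedAddCommGroup X] [NormedSpace ℝ X]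
    [CompleteSpace X] {A : ℝ → X →L[ℝ] X} {b : ℝ} (hA : ∀ t, ‖A t‖ ≤ b)
    (hcont : ∀ y : ℝ → X, Continuous y → Continuous fun t => A t (y t)) (x₀ : X) :
    ∃ χ : ℝ → X, χ 0 = x₀ ∧ ∀ t, HasDerivAt χ (A t (χ t)) t := by
  have hb : 0 ≤ b := (norm_nonneg _).trans (hA 0)
  -- The solution is sought as e^{L|t|} y with y bounded. In this weight, integration costs b/L ≤
  -- 1/2, so a single contraction covers all times; the +1 keeps L positive when b = 0.
  set L : ℝ := 2 * b + 1 with hLdef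
  have hL : 0 < L := by positivity
  let e : ℝ → ℝ := fun t => Real.exp (L * |t|)
  have he : Continuous e := by fun_prop
  have he0 : ∀ t, 0 < e t := fun t => Real.exp_pos _
  have he1 : ∀ t, 1 ≤ e t := fun t => Real.one_le_exp (by positivity)
  let f : (ℝ →ᵇ X) → ℝ → X := fun y s => A s (e s • y s)
  have hf : ∀ y, Continuous (f y) := fun y => hcont _ (he.smul y.continuous)
  have hfsub : ∀ (y z : ℝ →ᵇ X) s, ‖f y s - f z s‖ ≤ b * dist y z * Real.exp (L * |s|) :=
    fun y z s => by
      simp only [f]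
      rw [← map_sub, ← smul_sub]
      refine ((A s).le_of_opNorm_le (hA s) _).trans ?_
      rw [norm_smul, Real.norm_of_nonneg (he0 s).le, ← dist_eq_norm]
      have := y.dist_coe_le_dist (g := z) s
      calc b * (e s * dist (y s) (z s)) ≤ b * (e s * dist y z) := by gcongr
        _ = _ := by ring
  have hf0 : ∀ s, f 0 s = 0 := fun s => by simp [f]
  have hint : ∀ y : ℝ →ᵇ X, Continuous fun t => ∫ s in (0 : ℝ)..t, f y s := fun y =>
    intervalIntegral.continuous_primitive (fun _ _ => (hf y).intervalIntegrable _ _) 0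
  have hbound : ∀ y z : ℝ →ᵇ X, ∀ t,
      ‖(e t)⁻¹ • ((∫ s in (0 : ℝ)..t, f y s) - ∫ s in (0 : ℝ)..t, f z s)‖
        ≤ b / L * dist y z := fun y z t => by
    rw [← intervalIntegral.integral_sub ((hf y).intervalIntegrable _ _)
      ((hf z).intervalIntegrable _ _), norm_smul, norm_inv, Real.norm_of_nonneg (he0 t).le,
      inv_mul_le_iff₀ (he0 t)]
    refine (norm_intervalIntegral_le_exp (by positivity) hL (hfsub y z) t).trans (le_of_eq ?_)
    simp only [e]
    ring
  let Φ : (ℝ →ᵇ X) → (ℝ →ᵇ X) := fun y =>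
    BoundedContinuousFunction.ofNormedAddCommGroup
      (fun t => (e t)⁻¹ • (x₀ + ∫ s in (0 : ℝ)..t, f y s))
      ((he.inv₀ fun t => (he0 t).ne').smul (continuous_const.add (hint y)))
      (‖x₀‖ + b / L * dist y 0) fun t => by
        rw [smul_add]
        refine (norm_add_le _ _).trans (add_le_add ?_ ?_)
        · rw [norm_smul, norm_inv, Real.norm_of_nonneg (he0 t).le]
          exact mul_le_of_le_one_left (norm_nonneg _) (inv_le_one_of_one_le₀ (he1 t))
        · simpa [hf0] using hbound y 0 t
  have hΦ : ContractingWith (1 / 2) Φ := by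
    refine ⟨by norm_num, LipschitzWith.of_dist_le_mul fun y z => ?_⟩
    refine (BoundedContinuousFunction.dist_le (by positivity)).2 fun t => ?_
    rw [dist_eq_norm]
    have h1 : Φ y t - Φ z t
        = (e t)⁻¹ • ((∫ s in (0 : ℝ)..t, f y s) - ∫ s in (0 : ℝ)..t, f z s) := by
      simp only [Φ, BoundedContinuousFunction.coe_ofNormedAddCommGroup]
      rw [← smul_sub, add_sub_add_left_eq_sub]
    rw [h1]
    refine (hbound y z t).trans ?_
    have h2 : b / L ≤ 1 / 2 := by
      rw [div_le_iff₀ hL, hLdef]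
      linarith
    refine mul_le_mul_of_nonneg_right ?_ dist_nonneg
    simpa using h2
  obtain ⟨y, hy, -⟩ := hΦ.exists_fixedPoint 0 (edist_ne_top _ _)
  have hyt : ∀ t, e t • y t = x₀ + ∫ s in (0 : ℝ)..t, f y s := fun t => by
    have h1 : Φ y t = y t := by rw [hy]
    rw [← h1]
    simp only [Φ, BoundedContinuousFunction.coe_ofNormedAddCommGroup]
    rw [smul_smul, mul_inv_cancel₀ (he0 t).ne', one_smul]
  refine ⟨fun t => e t • y t, by simp only [hyt]; simp, fun t => ?_⟩
  have h1 : HasDerivAt (fun t => x₀ + ∫ s in (0 : ℝ)..t, f y s) (f y t) t :=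
    ((hf y).integral_hasStrictDerivAt 0 t).hasDerivAt.const_add _
  simp_rw [← hyt] at h1
  exact h1

/-- Grönwall for the norm instead of its square, which makes ε enter linearly in T. The norm is not
differentiable at 0, so √(‖χ‖² + d²) replaces it. -/
theorem norm_le_exp_mul_of_re_inner_le {X : Type*} [NormedAddCommGroup X] [InnerProductSpace ℂ X]
    [NormedSpace ℝ X] {χ χ' : ℝ → X} (hχ : ∀ t, HasDerivAt χ (χ' t) t) {k ε T : ℝ}
    (hk : 0 ≤ k) (hε : 0 ≤ ε) (hT : 0 ≤ T)
    (h : ∀ t ∈ Set.Icc 0 T, (⟪χ t, χ' t⟫_ℂ).re ≤ k * ‖χ t‖ ^ 2 + ε * ‖χ t‖) :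
    ‖χ T‖ ≤ Real.exp (k * T) * (‖χ 0‖ + ε * T) := by
  have hsq : ∀ t, HasDerivAt (fun s => ‖χ s‖ ^ 2) (2 * (⟪χ t, χ' t⟫_ℂ).re) t := fun t => by
    have h1 := Complex.reCLM.hasFDerivAt.comp_hasDerivAt t ((hχ t).inner ℂ (hχ t))
    have h2 : (⇑Complex.reCLM ∘ fun s => ⟪χ s, χ s⟫_ℂ) = fun s => ‖χ s‖ ^ 2 := by
      funext s
      simpa using (inner_self_eq_norm_sq (𝕜 := ℂ) (χ s))
    rw [h2] at h1
    refine h1.congr_deriv ?_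
    have h3 : (⟪χ' t, χ t⟫_ℂ).re = (⟪χ t, χ' t⟫_ℂ).re := by
      rw [← inner_conj_symm, Complex.conj_re]
    rw [Complex.reCLM_apply, Complex.add_re, h3]
    ring
  refine le_of_forall_pos_le_add fun η hη => ?_
  -- After amplification by e^{kT} the regularization costs exactly η.
  set d : ℝ := η / Real.exp (k * T) with hd
  have hd0 : 0 < d := by positivity
  let n : ℝ → ℝ := fun t => √(‖χ t‖ ^ 2 + d ^ 2)
  have hn0 : ∀ t, 0 < n t := fun t => Real.sqrt_pos.2 (by positivity)
  have hnle : ∀ t, ‖χ t‖ ≤ n t := fun t => Real.le_sqrt_of_sq_le (by nlinarith)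
  have hnsq : ∀ t, n t ^ 2 = ‖χ t‖ ^ 2 + d ^ 2 := fun t => Real.sq_sqrt (by positivity)
  have hn : ∀ t, HasDerivAt n ((⟪χ t, χ' t⟫_ℂ).re / n t) t := fun t => by
    refine (((hsq t).add_const (d ^ 2)).sqrt (by positivity)).congr_deriv ?_
    rw [mul_div_mul_left _ _ two_ne_zero]
  have hg : ∀ t, HasDerivAt (fun s => Real.exp (-(k * s)) * n s - ε * s)
      (Real.exp (-(k * t)) * ((⟪χ t, χ' t⟫_ℂ).re / n t - k * n t) - ε) t := fun t => by
    have h1 := ((((hasDerivAt_id t).const_mul k).neg.exp).mul (hn t)).sub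
      ((hasDerivAt_id t).const_mul ε)
    refine h1.congr_deriv ?_
    simp
    ring
  have hanti : AntitoneOn (fun s => Real.exp (-(k * s)) * n s - ε * s) (Set.Icc 0 T) := by
    refine antitoneOn_of_deriv_nonpos (convex_Icc 0 T)
      (fun t _ => (hg t).continuousAt.continuousWithinAt)
      (fun t _ => (hg t).differentiableAt.differentiableWithinAt) fun t ht => ?_
    rw [interior_Icc] at ht
    rw [(hg t).deriv]
    have h1 : (⟪χ t, χ' t⟫_ℂ).re / n t - k * n t ≤ ε := by
      rw [sub_le_iff_le_add, div_le_iff₀ (hn0 t)]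
      refine (h t ⟨ht.1.le, ht.2.le⟩).trans ?_
      have h2 := hnle t
      have h3 : k * ‖χ t‖ ^ 2 ≤ k * n t ^ 2 := by gcongr
      have h4 : ε * ‖χ t‖ ≤ ε * n t := by gcongr
      linarith
    have h2 : Real.exp (-(k * t)) ≤ 1 := Real.exp_le_one_iff.2 (by
      have := mul_nonneg hk ht.1.le
      linarith)
    have h3 := Real.exp_pos (-(k * t))
    nlinarith
  have h1 := hanti (Set.left_mem_Icc.2 hT) (Set.right_mem_Icc.2 hT) hT
  simp only [mul_zero, neg_zero, Real.exp_zero, one_mul, sub_zero] at h1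
  have h2 : n 0 ≤ ‖χ 0‖ + d := Real.sqrt_le_iff.2 ⟨by positivity, by
    have := norm_nonneg (χ 0)
    nlinarith⟩
  have h3 : Real.exp (-(k * T)) * n T ≤ ‖χ 0‖ + ε * T + d := by linarith
  rw [Real.exp_neg, inv_mul_le_iff₀ (Real.exp_pos _), mul_add] at h3
  rw [hd, mul_div_cancel₀ _ (Real.exp_ne_zero _)] at h3
  exact (hnle T).trans h3

variable {ι : Type*}

/-- The unitary group `exp(itD)` of the diagonal operator with real symbol `D`. -/
def phase (D : ι → ℝ) (t : ℝ) : L2 ι →L[ℂ] L2 ι :=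
  diag (fun i => Complex.exp ((t * D i : ℝ) * Complex.I)) 1 zero_le_one fun _ =>
    (Complex.norm_exp_ofReal_mul_I _).le

theorem phase_apply (D : ι → ℝ) (t : ℝ) (f : L2 ι) (i : ι) :
    phase D t f i = Complex.exp ((t * D i : ℝ) * Complex.I) * f i := rfl

theorem phase_zero (D : ι → ℝ) (f : L2 ι) : phase D 0 f = f := by
  ext i
  simp [phase_apply]

theorem phase_phase (D : ι → ℝ) (s t : ℝ) (f : L2 ι) :
    phase D s (phase D t f) = phase D (s + t) f := by
  ext i
  simp only [phase_apply]
  rw [← mul_assoc, ← Complex.exp_add]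
  congr 2
  push_cast
  ring

theorem inner_phase (D : ι → ℝ) (t : ℝ) (f g : L2 ι) :
    ⟪phase D t f, phase D t g⟫_ℂ = ⟪f, g⟫_ℂ := by
  rw [lp.inner_eq_tsum, lp.inner_eq_tsum]
  refine tsum_congr fun i => ?_
  simp only [phase_apply, RCLike.inner_apply, map_mul]
  have h : Complex.exp ((t * D i : ℝ) * Complex.I)
      * (starRingEnd ℂ) (Complex.exp ((t * D i : ℝ) * Complex.I)) = 1 := by
    rw [Complex.mul_conj, Complex.normSq_eq_norm_sq, Complex.norm_exp_ofReal_mul_I]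
    simp
  linear_combination (g i * (starRingEnd ℂ) (f i)) * h

theorem norm_phase_apply (D : ι → ℝ) (t : ℝ) (f : L2 ι) : ‖phase D t f‖ = ‖f‖ := by
  rw [norm_eq_sqrt_re_inner (𝕜 := ℂ), inner_phase, ← norm_eq_sqrt_re_inner]

/-- D may be unbounded, so only strong continuity is available; it follows by dominated convergence
in the components. -/
theorem continuous_phase_const (D : ι → ℝ) (f : L2 ι) : Continuous fun t => phase D t f := by
  refine continuous_iff_continuousAt.2 fun t₀ => ?_
  refine tendsto_iff_norm_sub_tendsto_zero.2 ?_
  have hsq : Tendsto (fun t => ‖phase D t f - phase D t₀ f‖ ^ 2) (𝓝 t₀) (𝓝 0) := by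
    have h1 : ∀ t, ‖phase D t f - phase D t₀ f‖ ^ 2
        = ∑' i, ‖phase D t f i - phase D t₀ f i‖ ^ 2 := fun t =>
      (hasSum_norm_sq (phase D t f - phase D t₀ f)).tsum_eq.symm
    simp_rw [h1]
    have h2 : (0 : ℝ) = ∑' i, ‖phase D t₀ f i - phase D t₀ f i‖ ^ 2 := by simp
    rw [h2]
    refine tendsto_tsum_of_dominated_convergence
      (bound := fun i => 4 * ‖f i‖ ^ 2) ((hasSum_norm_sq f).summable.mul_left 4)
      (fun i => ?_) (Eventually.of_forall fun t i => ?_)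
    · have h3 : Continuous fun t => ‖phase D t f i - phase D t₀ f i‖ ^ 2 := by
        simp only [phase_apply]
        fun_prop
      exact h3.tendsto t₀
    · have h3 : ∀ t, ‖phase D t f i‖ = ‖f i‖ := fun t => by
        rw [phase_apply, norm_mul, Complex.norm_exp_ofReal_mul_I, one_mul]
      have h4 := norm_sub_le (phase D t f i) (phase D t₀ f i)
      rw [h3, h3] at h4
      rw [Real.norm_of_nonneg (by positivity)]
      nlinarith [norm_nonneg (phase D t f i - phase D t₀ f i)]
  have h := (Real.continuous_sqrt.tendsto 0).comp hsq
  simpa [Function.comp_def] using h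

theorem continuous_phase (D : ι → ℝ) {τ : ℝ → ℝ} (hτ : Continuous τ) {x : ℝ → L2 ι}
    (hx : Continuous x) : Continuous fun t => phase D (τ t) (x t) := by
  refine continuous_iff_continuousAt.2 fun t₀ => ?_
  refine tendsto_iff_norm_sub_tendsto_zero.2 ?_
  have h1 : Tendsto (fun t => ‖x t - x t₀‖) (𝓝 t₀) (𝓝 0) :=
    tendsto_iff_norm_sub_tendsto_zero.1 (hx.tendsto t₀)
  have h2 : Tendsto (fun t => ‖phase D (τ t) (x t₀) - phase D (τ t₀) (x t₀)‖) (𝓝 t₀) (𝓝 0) :=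
    tendsto_iff_norm_sub_tendsto_zero.1
      (((continuous_phase_const D (x t₀)).comp hτ).tendsto t₀)
  refine squeeze_zero (fun _ => norm_nonneg _) (fun t => ?_) (by simpa using h1.add h2)
  have h3 : phase D (τ t) (x t) - phase D (τ t₀) (x t₀)
      = phase D (τ t) (x t - x t₀) + (phase D (τ t) (x t₀) - phase D (τ t₀) (x t₀)) := by
    rw [map_sub]
    abel
  rw [h3]
  refine (norm_add_le _ _).trans ?_
  rw [norm_phase_apply]

/-- A sequence-valued function with components differentiable and continuous derivative in `ℓ²`,
up to a diagonal rotation, is differentiable in `ℓ²` in the rotating frame. -/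
theorem hasDerivAt_phase {D : ι → ℝ} {φ F : ℝ → L2 ι} (hF : Continuous F)
    (h : ∀ i t, HasDerivAt (fun s => φ s i) (Complex.I * D i * φ t i + F t i) t) (t : ℝ) :
    HasDerivAt (fun s => phase D (-s) (φ s)) (phase D (-t) (F t)) t := by
  have hG : Continuous fun s => phase D (-s) (F s) := continuous_phase D continuous_neg hF
  set Y : ℝ → L2 ι := fun r => φ 0 + ∫ s in (0 : ℝ)..r, phase D (-s) (F s) with hY
  have hYd : ∀ r, HasDerivAt Y (phase D (-r) (F r)) r := fun r =>
    (hG.integral_hasStrictDerivAt 0 r).hasDerivAt.const_add _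
  have hYi : ∀ i r, HasDerivAt (fun s => Y s i) (phase D (-r) (F r) i) r := fun i r =>
    ((lp.evalCLM ℝ (fun _ : ι => ℂ) 2 i).hasFDerivAt.comp_hasDerivAt r (hYd r))
  have hχi : ∀ i r, HasDerivAt (fun s => phase D (-s) (φ s) i) (phase D (-r) (F r) i) r :=
    fun i r => by
      simp only [phase_apply]
      have h0 : HasDerivAt (fun s : ℝ => ((-s * D i : ℝ) : ℂ) * Complex.I)
          (((-1 * D i : ℝ) : ℂ) * Complex.I) r :=
        (((hasDerivAt_id r).neg.mul_const (D i)).ofReal_comp).mul_const _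
      refine (h0.cexp.mul (h i r)).congr_deriv ?_
      push_cast
      ring
  -- Components of both sides have equal derivatives and initial values. Identification with an
  -- ℓ²-valued integral upgrades componentwise differentiability to differentiability in ℓ².
  have hEq : (fun s => phase D (-s) (φ s)) = Y := by
    funext r
    ext i
    have hz : ∀ s, HasDerivAt (fun s => phase D (-s) (φ s) i - Y s i) 0 s := fun s =>
      ((hχi i s).sub (hYi i s)).congr_deriv (sub_self _)
    have hc := is_const_of_deriv_eq_zero (fun s => (hz s).differentiableAt)
      (fun s => (hz s).deriv) r 0
    have h0 : phase D (-0) (φ 0) i - Y 0 i = 0 := by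
      simp [hY, phase_zero]
    rw [h0] at hc
    exact sub_eq_zero.1 hc
  rw [hEq]
  exact hYd t

/-- The rotating frame is unitary, so D drops out of the energy balance and only F counts. -/
theorem norm_le_of_re_inner_le {D : ι → ℝ} {φ F : ℝ → L2 ι} (hF : Continuous F)
    (h : ∀ i t, HasDerivAt (fun s => φ s i) (Complex.I * D i * φ t i + F t i) t)
    {k ε T : ℝ} (hk : 0 ≤ k) (hε : 0 ≤ ε) (hT : 0 ≤ T)
    (hle : ∀ t ∈ Set.Icc 0 T, (⟪φ t, F t⟫_ℂ).re ≤ k * ‖φ t‖ ^ 2 + ε * ‖φ t‖) :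
    ‖φ T‖ ≤ Real.exp (k * T) * (‖φ 0‖ + ε * T) := by
  have := norm_le_exp_mul_of_re_inner_le (hasDerivAt_phase hF h) hk hε hT fun t ht => by
    rw [inner_phase, norm_phase_apply]
    exact hle t ht
  simpa only [norm_phase_apply] using this

/-- Mild solutions of `φ' = i (D + B) φ` in `ℓ²`, where `D` is diagonal and `B` is bounded. -/
structure IsTrajectory (D : ι → ℝ) (B : L2 ι →L[ℂ] L2 ι) (φ : ℝ → L2 ι) : Prop where
  continuous : Continuous φ
  hasDerivAt : ∀ i t,
    HasDerivAt (fun s => φ s i) (Complex.I * D i * φ t i + (Complex.I • B (φ t)) i) t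

theorem re_inner_I_smul_le {X : Type*} [NormedAddCommGroup X] [InnerProductSpace ℂ X] (x y : X) :
    (⟪x, Complex.I • y⟫_ℂ).re ≤ ‖x‖ * ‖y‖ := by
  refine (Complex.re_le_norm _).trans ((norm_inner_le_norm _ _).trans ?_)
  rw [norm_smul, Complex.norm_I, one_mul]

theorem re_inner_I_smul_eq_zero {X : Type*} [NormedAddCommGroup X] [InnerProductSpace ℂ X]
    {x y : X} (h : ⟪y, x⟫_ℂ = ⟪x, y⟫_ℂ) : (⟪x, Complex.I • y⟫_ℂ).re = 0 := by
  have him : (⟪x, y⟫_ℂ).im = 0 := by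
    rw [← Complex.conj_eq_iff_im, inner_conj_symm, h]
  rw [inner_smul_right]
  simp [him]

theorem exists_isTrajectory (D : ι → ℝ) (B : L2 ι →L[ℂ] L2 ι) (x₀ : L2 ι) :
    ∃ φ, IsTrajectory D B φ ∧ φ 0 = x₀ := by
  -- The generator in the rotating frame: uniformly bounded, and strongly continuous in t.
  let A : ℝ → L2 ι →L[ℂ] L2 ι := fun t => phase D (-t) ∘L (Complex.I • B) ∘L phase D t
  have hA : ∀ t, ‖(A t).restrictScalars ℝ‖ ≤ ‖Complex.I • B‖ := fun t => by
    rw [ContinuousLinearMap.norm_restrictScalars]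
    refine ContinuousLinearMap.opNorm_le_bound _ (norm_nonneg _) fun x => ?_
    simp only [A, ContinuousLinearMap.comp_apply]
    rw [norm_phase_apply]
    refine ((Complex.I • B).le_opNorm _).trans ?_
    rw [norm_phase_apply]
  obtain ⟨χ, hχ0, hχ⟩ := exists_forall_hasDerivAt hA (fun y hy => by
    simp only [A, ContinuousLinearMap.coe_restrictScalars', ContinuousLinearMap.comp_apply]
    exact continuous_phase D continuous_neg
      ((Complex.I • B).continuous.comp (continuous_phase D continuous_id hy))) x₀
  have hcχ : Continuous χ := continuous_iff_continuousAt.2 fun t => (hχ t).continuousAt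
  refine ⟨fun t => phase D t (χ t), ⟨continuous_phase D continuous_id hcχ, fun i t => ?_⟩, by
    simp only [phase_zero, hχ0]⟩
  have h1 : HasDerivAt (fun s => χ s i) ((A t) (χ t) i) t :=
    (lp.evalCLM ℝ (fun _ : ι => ℂ) 2 i).hasFDerivAt.comp_hasDerivAt t (hχ t)
  simp only [phase_apply]
  have h0 : HasDerivAt (fun s : ℝ => ((s * D i : ℝ) : ℂ) * Complex.I)
      (((1 * D i : ℝ) : ℂ) * Complex.I) t :=
    (((hasDerivAt_id t).mul_const (D i)).ofReal_comp).mul_const _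
  refine (h0.cexp.mul h1).congr_deriv ?_
  have h2 : Complex.exp ((t * D i : ℝ) * Complex.I) * (A t) (χ t) i
      = (Complex.I • B (phase D t (χ t))) i := by
    rw [← phase_apply]
    simp only [A, ContinuousLinearMap.comp_apply]
    rw [phase_phase, add_neg_cancel, phase_zero]
    rfl
  rw [h2]
  push_cast
  ring

namespace IsTrajectory

variable {D : ι → ℝ} {B : L2 ι →L[ℂ] L2 ι} {φ φ' : ℝ → L2 ι}

theorem continuous_source (h : IsTrajectory D B φ) : Continuous fun t => Complex.I • B (φ t) :=
  (Complex.I • B).continuous.comp h.continuous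

theorem sub (h : IsTrajectory D B φ) (h' : IsTrajectory D B φ') :
    IsTrajectory D B fun t => φ t - φ' t := by
  refine ⟨h.continuous.sub h'.continuous, fun i t => ?_⟩
  refine ((h.hasDerivAt i t).sub (h'.hasDerivAt i t)).congr_deriv ?_
  simp only [map_sub, smul_sub, lp.coeFn_sub, Pi.sub_apply]
  ring

/-- Time reversal, so that forward estimates give uniqueness at negative times too. -/
theorem comp_neg (h : IsTrajectory D B φ) :
    IsTrajectory (fun i => -D i) (-B) fun t => φ (-t) := by
  refine ⟨h.continuous.comp continuous_neg, fun i t => ?_⟩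
  have h1 := (h.hasDerivAt i (-t)).scomp t (hasDerivAt_neg t)
  refine h1.congr_deriv ?_
  simp only [neg_apply, smul_neg, lp.coeFn_neg, Pi.neg_apply, neg_smul,
    one_smul, Complex.ofReal_neg]
  ring

theorem norm_le_exp (h : IsTrajectory D B φ) {T : ℝ} (hT : 0 ≤ T) :
    ‖φ T‖ ≤ Real.exp (‖B‖ * T) * ‖φ 0‖ := by
  have := norm_le_of_re_inner_le h.continuous_source h.hasDerivAt (k := ‖B‖) (ε := 0)
    (norm_nonneg B) le_rfl hT fun t _ => by
      have h1 := re_inner_I_smul_le (φ t) (B (φ t))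
      have h2 := B.le_opNorm (φ t)
      have h3 := norm_nonneg (φ t)
      nlinarith
  simpa using this

theorem norm_le (h : IsTrajectory D B φ) (hB : ∀ x y, ⟪B x, y⟫_ℂ = ⟪x, B y⟫_ℂ) {T : ℝ}
    (hT : 0 ≤ T) : ‖φ T‖ ≤ ‖φ 0‖ := by
  have := norm_le_of_re_inner_le h.continuous_source h.hasDerivAt (k := 0) (ε := 0)
    le_rfl le_rfl hT fun t _ => by
      rw [re_inner_I_smul_eq_zero (hB _ _)]
      simp
  simpa using this

theorem unique (h : IsTrajectory D B φ) (h' : IsTrajectory D B φ') (h0 : φ 0 = φ' 0) :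
    φ = φ' := by
  funext t
  rw [← sub_eq_zero, ← norm_le_zero_iff]
  rcases le_total 0 t with ht | ht
  · simpa [h0] using (h.sub h').norm_le_exp ht
  · simpa [h0] using (h.sub h').comp_neg.norm_le_exp (neg_nonneg.2 ht)

end IsTrajectory

end Evolution

end DHW
end

noncomputable section

namespace DHW

open Filter Topology
open scoped InnerProductSpace

/-! ### Decoupling by a spectral gap and comparison with the compressed evolution. -/

section Reduction

/-- Solvability of a Riccati equation with a large spectral gap. -/
theorem exists_riccati {A : Type*} [NormedRing A] [CompleteSpace A] {K P S B : A} {d b Δ : ℝ}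
    (hK : ‖K‖ ≤ Δ⁻¹) (hP : ‖P‖ ≤ 1) (hS : ‖S‖ ≤ d) (hB : ‖B‖ ≤ b) (hΔ : 0 < Δ)
    (hgap : 2 * (d + 4 * b) ≤ Δ) :
    ∃ X : A, X = K * (X * P * (S + B) - B - B * X + X * P * B * X) * P ∧ ‖X‖ ≤ 2 * b / Δ := by
  have hb : 0 ≤ b := (norm_nonneg _).trans hB
  have hd : 0 ≤ d := (norm_nonneg _).trans hS
  have hmul : ∀ {x y : A} {r s : ℝ}, ‖x‖ ≤ r → ‖y‖ ≤ s → ‖x * y‖ ≤ r * s := fun hx hy =>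
    (norm_mul_le _ _).trans (mul_le_mul hx hy (norm_nonneg _) ((norm_nonneg _).trans hx))
  have hKP : ∀ {x : A} {r : ℝ}, ‖x‖ ≤ r → ‖K * x * P‖ ≤ Δ⁻¹ * r := fun hx => by
    simpa using hmul (hmul hK hx) hP
  have hXP : ∀ {x y : A} {r s : ℝ}, ‖x‖ ≤ r → ‖y‖ ≤ s → ‖x * P * y‖ ≤ r * s := fun hx hy => by
    simpa using hmul (hmul hx hP) hy
  have hSB : ‖S + B‖ ≤ d + b := (norm_add_le _ _).trans (add_le_add hS hB)
  -- On the unit ball the Lipschitz constant is Δ⁻¹(d + 4b) ≤ 1/2: d + b from S + B, b from BX, and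
  -- 2b from the quadratic term.
  let Φ : A → A := fun X => K * (X * P * (S + B) - B - B * X + X * P * B * X) * P
  have hnorm : ∀ X : A, ‖X‖ ≤ 1 → ‖Φ X‖ ≤ Δ⁻¹ * (b + (d + 3 * b) * ‖X‖) := fun X hX => by
    refine hKP ((norm_add_le _ _).trans ?_)
    have h1 : ‖X * P * (S + B)‖ ≤ ‖X‖ * (d + b) := hXP le_rfl hSB
    have h2 : ‖B * X‖ ≤ b * ‖X‖ := hmul hB le_rfl
    have h3 : ‖X * P * B * X‖ ≤ ‖X‖ * b * 1 := hmul (hXP le_rfl hB) hX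
    have h4 := norm_sub_le (X * P * (S + B) - B) (B * X)
    have h5 := norm_sub_le (X * P * (S + B)) B
    linarith
  have hΔd : Δ⁻¹ * (d + 4 * b) ≤ 1 / 2 := by
    rw [inv_mul_le_iff₀ hΔ]
    linarith
  have hmaps : Set.MapsTo Φ (Metric.closedBall 0 1) (Metric.closedBall 0 1) := fun X hX => by
    rw [mem_closedBall_zero_iff] at hX ⊢
    refine (hnorm X hX).trans ?_
    have h1 : b + (d + 3 * b) * ‖X‖ ≤ d + 4 * b := by nlinarith
    have h2 : Δ⁻¹ * (b + (d + 3 * b) * ‖X‖) ≤ Δ⁻¹ * (d + 4 * b) := by gcongr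
    linarith
  have hcontr : ContractingWith (1 / 2) (hmaps.restrict Φ _ _) := by
    refine ⟨by norm_num, LipschitzWith.of_dist_le_mul fun X Y => ?_⟩
    obtain ⟨X, hX⟩ := X
    obtain ⟨Y, hY⟩ := Y
    rw [mem_closedBall_zero_iff] at hX hY
    rw [Subtype.dist_eq, Subtype.dist_eq]
    simp only [Set.MapsTo.val_restrict_apply, dist_eq_norm]
    have hdiff : Φ X - Φ Y = K * ((X - Y) * P * (S + B) - B * (X - Y) + (X - Y) * P * B * X
        + Y * P * B * (X - Y)) * P := by
      simp only [Φ]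
      noncomm_ring
    rw [hdiff]
    have h1 : ‖(X - Y) * P * (S + B)‖ ≤ ‖X - Y‖ * (d + b) := hXP le_rfl hSB
    have h2 : ‖B * (X - Y)‖ ≤ b * ‖X - Y‖ := hmul hB le_rfl
    have h3 : ‖(X - Y) * P * B * X‖ ≤ ‖X - Y‖ * b * 1 := hmul (hXP le_rfl hB) hX
    have h4 : ‖Y * P * B * (X - Y)‖ ≤ 1 * b * ‖X - Y‖ := hmul (hXP hY hB) le_rfl
    have h5 : ‖(X - Y) * P * (S + B) - B * (X - Y) + (X - Y) * P * B * X
        + Y * P * B * (X - Y)‖ ≤ (d + 4 * b) * ‖X - Y‖ := by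
      refine (norm_add_le _ _).trans ?_
      have h6 := norm_add_le ((X - Y) * P * (S + B) - B * (X - Y)) ((X - Y) * P * B * X)
      have h7 := norm_sub_le ((X - Y) * P * (S + B)) (B * (X - Y))
      linarith
    refine (hKP h5).trans ?_
    rw [← mul_assoc]
    refine mul_le_mul_of_nonneg_right ?_ (norm_nonneg _)
    simpa using hΔd
  obtain ⟨X, hXmem, hX, -⟩ := ContractingWith.exists_fixedPoint' Metric.isClosed_closedBall.isComplete
    hmaps hcontr (Metric.mem_closedBall_self zero_le_one) (edist_ne_top _ _)
  rw [mem_closedBall_zero_iff] at hXmem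
  refine ⟨X, hX.symm, ?_⟩
  -- At the fixed point Δ‖X‖ ≤ b + (d + 3b)‖X‖, and the last term is at most half the left side.
  have h1 := hnorm X hXmem
  rw [hX, le_inv_mul_iff₀ hΔ] at h1
  rw [le_div_iff₀ hΔ]
  have h2 := norm_nonneg X
  nlinarith

variable {ι : Type*} {D : ι → ℝ} {B B' : L2 ι →L[ℂ] L2 ι} {φ η : ℝ → L2 ι}

/-- Diagonal operators commute with D, so only B has to be intertwined. Serves both for cutting off
to G and for exponential weights. -/
theorem IsTrajectory.map_diag (h : IsTrajectory D B φ) {m : ι → ℂ} {C : ℝ} {hC : 0 ≤ C}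
    {hm : ∀ i, ‖m i‖ ≤ C} (hcomm : ∀ x, diag m C hC hm (B x) = B' (diag m C hC hm x)) :
    IsTrajectory D B' fun t => diag m C hC hm (φ t) := by
  refine ⟨(diag m C hC hm).continuous.comp h.continuous, fun i t => ?_⟩
  simp only [diag_apply]
  refine ((h.hasDerivAt i t).const_mul (m i)).congr_deriv ?_
  rw [← hcomm]
  simp only [lp.coeFn_smul, Pi.smul_apply, smul_eq_mul, diag_apply]
  ring

theorem sub_proj_eq {R N : Set ι} (hRN : Disjoint R N) (f : L2 ι) :
    f - proj R f = proj N f + proj (R ∪ N)ᶜ f := by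
  ext i
  simp only [lp.coeFn_add, Pi.add_apply, lp.coeFn_sub, Pi.sub_apply]
  by_cases hi : i ∈ R
  · have hi' : i ∉ N := Set.disjoint_left.1 hRN hi
    have hi'' : i ∉ (R ∪ N)ᶜ := fun hc => hc (Or.inl hi)
    rw [proj_apply_of_mem hi, proj_apply_of_notMem hi', proj_apply_of_notMem hi'']
    simp
  · by_cases hi' : i ∈ N
    · have hi'' : i ∉ (R ∪ N)ᶜ := fun hc => hc (Or.inr hi')
      rw [proj_apply_of_notMem hi, proj_apply_of_mem hi', proj_apply_of_notMem hi'']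
      simp
    · have hi'' : i ∈ (R ∪ N)ᶜ := fun hc => hc.elim hi hi'
      rw [proj_apply_of_notMem hi, proj_apply_of_notMem hi', proj_apply_of_mem hi'']
      simp

/-- Amplitudes that start on `R` stay small on a set `N` that is separated from `R` by a spectral
gap `Δ`, uniformly in time up to the leakage through the complement of `R ∪ N`. -/
theorem IsTrajectory.norm_proj_le_of_gap (h : IsTrajectory D B φ)
    (hsymm : ∀ x y, ⟪B x, y⟫_ℂ = ⟪x, B y⟫_ℂ) {b d Δ ε T : ℝ} (hB : ‖B‖ ≤ b) {R N : Set ι}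
    (hRN : Disjoint R N) (hR : ∀ i ∈ R, |D i| ≤ d) (hN : ∀ i ∈ N, Δ ≤ |D i|) (hd : 0 ≤ d)
    (hΔ : 0 < Δ) (hgap : 2 * (d + 4 * b) ≤ Δ) (h0 : ∀ i, i ∉ R → φ 0 i = 0) (hT : 0 ≤ T)
    (hε : ∀ t ∈ Set.Icc 0 T, ‖proj (R ∪ N)ᶜ (φ t)‖ ≤ ε) :
    ‖proj N (φ T)‖ ≤ 2 * b / Δ * ‖φ 0‖
      + Real.exp (2 * b / Δ * b * T) * (2 * b / Δ * ‖φ 0‖ + 2 * b * ε * T) := by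
  classical
  have hb : 0 ≤ b := (norm_nonneg _).trans hB
  have hε0 : 0 ≤ ε := (norm_nonneg _).trans (hε 0 (Set.left_mem_Icc.2 hT))
  set x : ℝ := 2 * b / Δ with hx
  have hx0 : 0 ≤ x := by positivity
  have hx1 : x ≤ 1 := by
    rw [hx, div_le_one hΔ]
    linarith
  -- S is D on R and K is D⁻¹ on N, both extended by zero. The Riccati equation then says that the
  -- graph {p + Xp} over R is invariant under D + B truncated to R ∪ N.
  let S : L2 ι →L[ℂ] L2 ι := diag (fun i => if i ∈ R then (D i : ℂ) else 0) d hd fun i => by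
    split_ifs with hi
    · simpa using hR i hi
    · simpa using hd
  let K : L2 ι →L[ℂ] L2 ι := diag (fun i => if i ∈ N then (D i : ℂ)⁻¹ else 0) Δ⁻¹
    (inv_nonneg.2 hΔ.le) fun i => by
      split_ifs with hi
      · rw [norm_inv, Complex.norm_real]
        exact inv_anti₀ hΔ (hN i hi)
      · simpa using hΔ.le
  obtain ⟨X, hXeq, hXx⟩ := exists_riccati (K := K) (P := proj R) (S := S) (B := B)
    (norm_diag_le _ _ _ _) (norm_proj_le R) (norm_diag_le _ _ _ _) hB hΔ hgap
  have hXn : ∀ f, ‖X f‖ ≤ x * ‖f‖ := fun f => X.le_of_opNorm_le hXx f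
  have hBn : ∀ f, ‖B f‖ ≤ b * ‖f‖ := fun f => B.le_of_opNorm_le hB f
  have hXf : ∀ f, X f = K (X (proj R (S (proj R f) + B (proj R f))) - B (proj R f)
      - B (X (proj R f)) + X (proj R (B (X (proj R f))))) := fun f => by
    conv_lhs => rw [hXeq]
    rfl
  have hXP : ∀ f, X (proj R f) = X f := fun f => by
    rw [hXf (proj R f), hXf f]
    simp only [proj_proj]
  have hSR : ∀ f, S (proj R f) = S f := fun f => by
    ext i
    by_cases hi : i ∈ R
    · simp [S, proj_apply_of_mem hi]
    · simp [S, hi]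
  have hXf' : ∀ f, X f = K (X (S f + B (proj R f)) - B (proj R f) - B (X f) + X (B (X f))) :=
    fun f => by
      conv_lhs => rw [hXf]
      simp only [hXP, hSR]
  have hX0 : ∀ f i, i ∉ N → X f i = 0 := fun f i hi => by
    rw [hXf']
    simp [K, hi]
  have hXD : ∀ f i, i ∈ N →
      (D i : ℂ) * X f i = X (S f) i + X (B (proj R f)) i - B (proj R f) i - B (X f) i
        + X (B (X f)) i := fun f i hi => by
    have hDi : (D i : ℂ) ≠ 0 := by
      have := hN i hi
      have h1 : 0 < |D i| := hΔ.trans_le this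
      exact_mod_cast abs_pos.1 h1
    conv_lhs => rw [hXf']
    simp only [K, diag_apply, if_pos hi]
    rw [mul_inv_cancel_left₀ hDi]
    simp only [map_add, lp.coeFn_add, lp.coeFn_sub, Pi.add_apply, Pi.sub_apply]
  have hcont := h.continuous
  have hp : ∀ t, HasDerivAt (fun s => proj R (φ s))
      (Complex.I • (S (φ t) + proj R (B (φ t)))) t := fun t => by
    -- D is bounded on R, so the R-part is differentiable in ℓ² without rotation; hence the zero
    -- symbol, with S moved into the source.
    have h1 := hasDerivAt_phase (D := fun _ : ι => (0 : ℝ)) (φ := fun s => proj R (φ s))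
      (F := fun t => Complex.I • (S (φ t) + proj R (B (φ t)))) (by fun_prop) (fun i t => by
        by_cases hi : i ∈ R
        · simp only [proj_apply_of_mem hi]
          refine (h.hasDerivAt i t).congr_deriv ?_
          simp only [lp.coeFn_smul, lp.coeFn_add, Pi.smul_apply, Pi.add_apply, smul_eq_mul,
            proj_apply_of_mem hi, S, diag_apply, if_pos hi]
          push_cast
          ring
        · simp only [proj_apply_of_notMem hi]
          refine (hasDerivAt_const t (0 : ℂ)).congr_deriv ?_
          simp only [lp.coeFn_smul, lp.coeFn_add, Pi.smul_apply, Pi.add_apply, smul_eq_mul,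
            proj_apply_of_notMem hi, S, diag_apply, if_neg hi]
          simp) t
    have h2 : ∀ s (f : L2 ι), phase (fun _ : ι => (0 : ℝ)) s f = f := fun s f => by
      ext i
      simp [phase_apply]
    simpa only [h2] using h1
  have hXφ : ∀ i t, HasDerivAt (fun s => X (φ s) i)
      (Complex.I * (X (S (φ t)) i + X (B (φ t)) i)) t := fun i t => by
    have h1 : HasDerivAt (fun s => X (proj R (φ s)))
        (X (Complex.I • (S (φ t) + proj R (B (φ t))))) t :=
      (X.restrictScalars ℝ).hasFDerivAt.comp_hasDerivAt t (hp t)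
    have h2 : HasDerivAt (fun s => X (proj R (φ s)) i)
        (X (Complex.I • (S (φ t) + proj R (B (φ t)))) i) t :=
      (lp.evalCLM ℝ (fun _ : ι => ℂ) 2 i).hasFDerivAt.comp_hasDerivAt t h1
    simp only [hXP] at h2
    refine h2.congr_deriv ?_
    simp only [map_smul, map_add, hXP, lp.coeFn_smul, lp.coeFn_add, Pi.smul_apply, Pi.add_apply,
      smul_eq_mul]
  -- The deviation from the invariant graph: by the Riccati equation the R-part of φ cancels from
  -- its source, leaving only w, which is u plus the leakage outside R ∪ N.
  let u : ℝ → L2 ι := fun t => proj N (φ t) - X (φ t)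
  let w : ℝ → L2 ι := fun t => φ t - proj R (φ t) - X (φ t)
  let F : ℝ → L2 ι := fun t => Complex.I • (proj N (B (w t)) - X (B (w t)))
  have hu : ∀ i t, HasDerivAt (fun s => u s i) (Complex.I * D i * u t i + F t i) t := fun i t => by
    by_cases hi : i ∈ N
    · simp only [u, lp.coeFn_sub, Pi.sub_apply, proj_apply_of_mem hi]
      refine ((h.hasDerivAt i t).sub (hXφ i t)).congr_deriv ?_
      simp only [F, w, lp.coeFn_smul, lp.coeFn_sub, Pi.smul_apply, Pi.sub_apply, smul_eq_mul,
        proj_apply_of_mem hi, map_sub]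
      linear_combination Complex.I * hXD (φ t) i hi
    · simp only [u, lp.coeFn_sub, Pi.sub_apply, proj_apply_of_notMem hi, hX0 _ i hi]
      refine (hasDerivAt_const t ((0 : ℂ) - 0)).congr_deriv ?_
      simp only [F, lp.coeFn_smul, lp.coeFn_sub, Pi.smul_apply, Pi.sub_apply, smul_eq_mul,
        proj_apply_of_notMem hi, hX0 _ i hi]
      simp
  have hFc : Continuous F := by
    simp only [F, w]
    fun_prop
  have hQu : ∀ t, proj N (u t) = u t := fun t => proj_eq_self fun i hi => by
    simp only [u, lp.coeFn_sub, Pi.sub_apply, proj_apply_of_notMem hi, hX0 _ i hi, sub_zero]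
  have hw : ∀ t, w t = u t + proj (R ∪ N)ᶜ (φ t) := fun t => by
    simp only [w, u]
    rw [sub_proj_eq hRN]
    abel
  have hgrow := norm_le_of_re_inner_le hFc hu (k := x * b) (ε := 2 * b * ε) (by positivity)
    (by positivity) hT fun t ht => by
      have hq := hε t ht
      -- The coupling compressed to N is symmetric and does no work on u; growth comes only from
      -- XBu, hence the rate xb instead of b.
      have hsplit : F t = Complex.I • proj N (B (u t))
          + Complex.I • (proj N (B (proj (R ∪ N)ᶜ (φ t))) - X (B (w t))) := by
        rw [← smul_add]
        simp only [F]
        congr 1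
        conv_lhs => rw [hw t, map_add, map_add, ← map_add B, ← hw t]
        abel
      rw [hsplit, inner_add_right, Complex.add_re, re_inner_I_smul_eq_zero, zero_add]
      · refine (re_inner_I_smul_le _ _).trans ?_
        have h1 : ‖proj N (B (proj (R ∪ N)ᶜ (φ t)))‖ ≤ b * ε :=
          (norm_proj_apply_le _ _).trans ((hBn _).trans (by gcongr))
        have h2 : ‖w t‖ ≤ ‖u t‖ + ε := by
          rw [hw]
          exact (norm_add_le _ _).trans (by gcongr)
        have h3 : ‖X (B (w t))‖ ≤ x * (b * (‖u t‖ + ε)) :=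
          (hXn _).trans (by
            have := hBn (w t)
            gcongr
            exact this.trans (by gcongr))
        have h4 := (norm_sub_le (proj N (B (proj (R ∪ N)ᶜ (φ t)))) (X (B (w t)))).trans
          (add_le_add h1 h3)
        have h5 : x * (b * ε) ≤ 1 * (b * ε) := by gcongr
        calc ‖u t‖ * ‖proj N (B (proj (R ∪ N)ᶜ (φ t))) - X (B (w t))‖
            ≤ ‖u t‖ * (x * b * ‖u t‖ + 2 * b * ε) := by
              gcongr
              linarith
          _ = _ := by ring
      · rw [inner_proj_left, ← inner_proj_left N (u t), hQu, hsymm]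
  have hu0 : ‖u 0‖ ≤ x * ‖φ 0‖ := by
    have h1 : proj N (φ 0) = 0 := by
      ext i
      by_cases hi : i ∈ N
      · rw [proj_apply_of_mem hi, h0 i (Set.disjoint_right.1 hRN hi)]
        rfl
      · rw [proj_apply_of_notMem hi]
        rfl
    simp only [u, h1, zero_sub, norm_neg]
    exact hXn _
  have hfin : proj N (φ T) = X (φ T) + u T := by simp [u]
  rw [hfin]
  refine (norm_add_le _ _).trans (add_le_add ?_ (hgrow.trans (by gcongr)))
  refine (hXn _).trans ?_
  have := h.norm_le hsymm hT
  gcongr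

/-- Comparison of the full evolution with the evolution compressed to `R`. -/
theorem IsTrajectory.norm_sub_proj_le (h : IsTrajectory D B φ)
    (hsymm : ∀ x y, ⟪B x, y⟫_ℂ = ⟪x, B y⟫_ℂ) {R : Set ι}
    (hη : IsTrajectory D B' η) (hB' : ∀ x, B' x = proj R (B (proj R x))) (h0 : η 0 = proj R (φ 0))
    {b m T : ℝ} (hB : ‖B‖ ≤ b) (hT : 0 ≤ T) (hm : ∀ t ∈ Set.Icc 0 T, ‖φ t - proj R (φ t)‖ ≤ m) :
    ‖η T - proj R (φ T)‖ ≤ b * m * T := by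
  have hb : 0 ≤ b := (norm_nonneg _).trans hB
  have hm0 : 0 ≤ m := (norm_nonneg _).trans (hm 0 (Set.left_mem_Icc.2 hT))
  let e : ℝ → L2 ι := fun t => η t - proj R (φ t)
  let F : ℝ → L2 ι := fun t => Complex.I • proj R (B (proj R (η t) - φ t))
  have hφc := h.continuous
  have hηc := hη.continuous
  have he : ∀ i t, HasDerivAt (fun s => e s i) (Complex.I * D i * e t i + F t i) t := fun i t => by
    have h1 := hη.hasDerivAt i t
    by_cases hi : i ∈ R
    · simp only [e, lp.coeFn_sub, Pi.sub_apply, proj_apply_of_mem hi]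
      refine (h1.sub (h.hasDerivAt i t)).congr_deriv ?_
      simp only [F, hB', lp.coeFn_smul, lp.coeFn_sub, Pi.smul_apply, Pi.sub_apply, smul_eq_mul,
        proj_apply_of_mem hi, map_sub]
      ring
    · simp only [e, lp.coeFn_sub, Pi.sub_apply, proj_apply_of_notMem hi, sub_zero]
      refine h1.congr_deriv ?_
      simp only [F, hB', lp.coeFn_smul, Pi.smul_apply, smul_eq_mul, proj_apply_of_notMem hi]
  have hFc : Continuous F := by
    simp only [F]
    fun_prop
  have hgrow := norm_le_of_re_inner_le hFc he (k := 0) (ε := b * m) le_rfl (by positivity) hT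
    fun t ht => by
      -- The compressed coupling is symmetric, so the error grows linearly in time, driven by the
      -- off-R part of φ alone.
      have hsplit : F t = Complex.I • proj R (B (proj R (e t)))
          + Complex.I • (-proj R (B (φ t - proj R (φ t)))) := by
        rw [← smul_add]
        simp only [F, e, map_sub, proj_proj]
        congr 1
        abel
      rw [hsplit, inner_add_right, Complex.add_re, re_inner_I_smul_eq_zero, zero_add, zero_mul,
        zero_add, mul_comm]
      · refine (re_inner_I_smul_le _ _).trans ?_
        rw [norm_neg]
        gcongr
        exact (norm_proj_apply_le _ _).trans
          ((B.le_of_opNorm_le hB _).trans (by have := hm t ht; gcongr))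
      · rw [inner_proj_left, ← inner_proj_left R (e t), hsymm]
  have he0 : e 0 = 0 := by simp [e, h0]
  simpa [he0] using hgrow

end Reduction

end DHW
end

noncomputable section

namespace DHW

open Filter Topology
open scoped InnerProductSpace

/-! ### Coordinates and summability on the dual lattice. -/

section Lattice

theorem rho_eq (k₀ : E3) (g : DualLattice) : rho k₀ g = k₀ 2 + g 2 := by
  simp [rho, normal, waveVector, EuclideanSpace.inner_single_right]

theorem sigma_eq (k₀ : E3) (g : DualLattice) :
    sigma k₀ g = -(2 * (k₀ 0 * g 0 + k₀ 1 * g 1 + k₀ 2 * g 2) + ‖waveVector g‖ ^ 2) := by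
  simp only [sigma, EuclideanSpace.norm_sq_eq, Fin.sum_univ_three, waveVector, PiLp.add_apply,
    Real.norm_eq_abs, sq_abs]
  ring

theorem norm_waveVector_sq (g : DualLattice) :
    ‖waveVector g‖ ^ 2 = (g 0 : ℝ) ^ 2 + (g 1 : ℝ) ^ 2 + (g 2 : ℝ) ^ 2 := by
  simp [EuclideanSpace.norm_sq_eq, Fin.sum_univ_three, waveVector]

theorem waveVector_add (g h : DualLattice) :
    waveVector (g + h) = waveVector g + waveVector h := by
  ext i
  simp [waveVector]

theorem waveVector_zero : waveVector 0 = 0 := by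
  ext i
  simp [waveVector]

theorem abs_le_norm_waveVector (g : DualLattice) (i : Fin 3) : |(g i : ℝ)| ≤ ‖waveVector g‖ := by
  simpa [waveVector] using PiLp.norm_apply_le (waveVector g) i

theorem norm_waveVector_le_add (g h : DualLattice) :
    ‖waveVector g‖ ≤ ‖waveVector h‖ + ‖waveVector (g - h)‖ := by
  have h1 : g = h + (g - h) := by abel
  conv_lhs => rw [h1, waveVector_add]
  exact norm_add_le _ _

theorem summable_exp_neg_mul_abs {c : ℝ} (hc : 0 < c) :
    Summable fun n : ℤ => Real.exp (-c * |(n : ℝ)|) := by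
  have h : Summable fun n : ℕ => Real.exp (n * -c) :=
    Real.summable_exp_nat_mul_iff.2 (by linarith)
  have h' : Summable fun n : ℕ => Real.exp (-c * |((n : ℤ) : ℝ)|) :=
    h.congr fun n => by rw [Int.cast_natCast, Nat.abs_cast, mul_comm]
  refine Summable.of_nat_of_neg h' (h'.congr fun n => ?_)
  simp

theorem summable_exp_neg_mul_norm {a : ℝ} (ha : 0 < a) :
    Summable fun g : DualLattice => Real.exp (-a * ‖waveVector g‖) := by
  -- The rate a/3 comes from |g_0| + |g_1| + |g_2| ≤ 3|g|, which reduces the sum to a product of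
  -- one-dimensional ones.
  let f : ℤ → ℝ := fun n => Real.exp (-(a / 3) * |(n : ℝ)|)
  have hf : Summable f := summable_exp_neg_mul_abs (by positivity)
  have hf0 : 0 ≤ f := fun n => (Real.exp_pos _).le
  have hff : Summable fun p : ℤ × ℤ => f p.1 * f p.2 := hf.mul_of_nonneg hf hf0 hf0
  have hfff : Summable fun p : ℤ × ℤ × ℤ => f p.1 * (f p.2.1 * f p.2.2) :=
    hf.mul_of_nonneg hff hf0 fun p => mul_nonneg (hf0 _) (hf0 _)
  have hinj : Function.Injective fun g : DualLattice => (g 0, g 1, g 2) := fun g h hgh => by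
    simp only [Prod.mk.injEq] at hgh
    funext i
    fin_cases i
    exacts [hgh.1, hgh.2.1, hgh.2.2]
  refine Summable.of_nonneg_of_le (fun g => (Real.exp_pos _).le) (fun g => ?_)
    (hfff.comp_injective hinj)
  simp only [Function.comp_apply, f]
  rw [← Real.exp_add, ← Real.exp_add, Real.exp_le_exp]
  have h0 := abs_le_norm_waveVector g 0
  have h1 := abs_le_norm_waveVector g 1
  have h2 := abs_le_norm_waveVector g 2
  nlinarith

end Lattice

/-! ### The substitution φ_g = √ρ_g ψ_g and well-posedness of the original system. -/

section Symmetrization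

variable {k₀ : E3} {U : DualLattice → ℂ} {G : Set DualLattice} {m : ℝ}

/-- The diagonal symbol `π σ_g / ρ_g` of the symmetrized system. -/
def symbol (k₀ : E3) (g : DualLattice) : ℝ := Real.pi * sigma k₀ g / rho k₀ g

open Classical in
/-- The coupling kernel `π U_{g-h} / √(ρ_g ρ_h)` of the symmetrized system on `G`. -/
def coupling (k₀ : E3) (U : DualLattice → ℂ) (G : Set DualLattice) (g h : DualLattice) : ℂ :=
  if g ∈ G ∧ h ∈ G then Real.pi * U (g - h) / (√(rho k₀ g) * √(rho k₀ h)) else 0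

/-- `B` is the operator on `ℓ²` with kernel `coupling k₀ U G`. -/
def IsCoupling (k₀ : E3) (U : DualLattice → ℂ) (G : Set DualLattice)
    (B : L2 DualLattice →L[ℂ] L2 DualLattice) : Prop :=
  ∀ (f : L2 DualLattice) g, HasSum (fun h => coupling k₀ U G g h * f h) (B f g)

theorem norm_coupling_le (hm : 0 < m) (hG : ∀ g ∈ G, m ≤ rho k₀ g) (g h : DualLattice) :
    ‖coupling k₀ U G g h‖ ≤ Real.pi / m * ‖U (g - h)‖ := by
  unfold coupling
  split_ifs with hgh
  · have h1 : √m * √m ≤ √(rho k₀ g) * √(rho k₀ h) :=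
      mul_le_mul (Real.sqrt_le_sqrt (hG g hgh.1)) (Real.sqrt_le_sqrt (hG h hgh.2))
        (Real.sqrt_nonneg _) (Real.sqrt_nonneg _)
    rw [Real.mul_self_sqrt hm.le] at h1
    rw [norm_div, norm_mul, norm_mul, Complex.norm_real, Complex.norm_real, Complex.norm_real,
      Real.norm_of_nonneg Real.pi_pos.le, Real.norm_of_nonneg (Real.sqrt_nonneg _),
      Real.norm_of_nonneg (Real.sqrt_nonneg _), div_mul_eq_mul_div]
    gcongr
  · rw [norm_zero]
    have := Real.pi_pos
    positivity

theorem coupling_comm (hU : ∀ g, U (-g) = star (U g)) (g h : DualLattice) :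
    coupling k₀ U G h g = star (coupling k₀ U G g h) := by
  unfold coupling
  by_cases hg : g ∈ G <;> by_cases hh : h ∈ G
  · rw [if_pos ⟨hh, hg⟩, if_pos ⟨hg, hh⟩, ← neg_sub g h, hU]
    simp [mul_comm]
  all_goals simp [hg, hh]

theorem IsCoupling.symm {B : L2 DualLattice →L[ℂ] L2 DualLattice} (hB : IsCoupling k₀ U G B)
    (hU : ∀ g, U (-g) = star (U g)) (x y : L2 DualLattice) : ⟪B x, y⟫_ℂ = ⟪x, B y⟫_ℂ :=
  inner_comm_of_kernel (coupling_comm hU) hB x y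

theorem exists_isCoupling (hm : 0 < m) (hG : ∀ g ∈ G, m ≤ rho k₀ g) {v : DualLattice → ℝ}
    (hv : Summable v) (hU : ∀ g, ‖U g‖ ≤ v g) :
    ∃ B, IsCoupling k₀ U G B ∧ ‖B‖ ≤ Real.pi / m * ∑' g, v g := by
  have := Real.pi_pos
  obtain ⟨B, hB, hB'⟩ := exists_kernel_operator (hv.mul_left (Real.pi / m))
    (K := coupling k₀ U G) fun g h =>
      (norm_coupling_le hm hG g h).trans (by have := hU (g - h); gcongr)
  rw [tsum_mul_left] at hB
  exact ⟨B, hB', hB⟩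

variable {B : L2 DualLattice →L[ℂ] L2 DualLattice}

theorem IsCoupling.apply_of_notMem (hB : IsCoupling k₀ U G B) {g : DualLattice} (hg : g ∉ G)
    (f : L2 DualLattice) : B f g = 0 := by
  refine (hB f g).unique ?_
  simp [coupling, hg, hasSum_zero]

theorem IsCoupling.apply_proj (hB : IsCoupling k₀ U G B) (f : L2 DualLattice) :
    B (proj G f) = B f := by
  ext g
  refine (hB (proj G f) g).unique ?_
  convert hB f g using 2 with h
  by_cases hh : h ∈ G
  · rw [proj_apply_of_mem hh]
  · simp [coupling, hh]

theorem IsCoupling.proj_apply (hB : IsCoupling k₀ U G B) (f : L2 DualLattice) :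
    proj G (B f) = B f :=
  proj_eq_self fun _ hg => hB.apply_of_notMem hg f

theorem IsCoupling.restrict {R : Set DualLattice} (hRG : R ⊆ G)
    {B' : L2 DualLattice →L[ℂ] L2 DualLattice} (hB : IsCoupling k₀ U G B)
    (hB' : IsCoupling k₀ U R B') (f : L2 DualLattice) : B' f = proj R (B (proj R f)) := by
  ext g
  by_cases hg : g ∈ R
  · rw [proj_apply_of_mem hg]
    refine (hB' f g).unique ?_
    convert hB (proj R f) g using 2 with h
    by_cases hh : h ∈ R
    · simp [coupling, hg, hh, hRG hg, hRG hh, proj_apply_of_mem hh]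
    · rw [proj_apply_of_notMem hh]
      simp [coupling, hh]
  · rw [proj_apply_of_notMem hg, hB'.apply_of_notMem hg]

theorem IsCoupling.hasSum_subtype (hB : IsCoupling k₀ U G B) (hm : 0 < m)
    (hG : ∀ g ∈ G, m ≤ rho k₀ g) {f : L2 DualLattice} {A : DualLattice → ℂ}
    (hf : ∀ g ∈ G, f g = √(rho k₀ g) * A g) {g : DualLattice} (hg : g ∈ G) :
    HasSum (fun h : G => U (g - h) * A h) (√(rho k₀ g) / Real.pi * B f g) := by
  have h1 := hB f g
  have h2 : Function.support (fun h => coupling k₀ U G g h * f h) ⊆ G := fun h hh => by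
    by_contra hc
    exact hh (by simp [coupling, hc])
  rw [← hasSum_subtype_iff_of_support_subset h2] at h1
  have hne : ∀ g ∈ G, (√(rho k₀ g) : ℂ) ≠ 0 := fun g hg => by
    exact_mod_cast (Real.sqrt_pos.2 (hm.trans_le (hG g hg))).ne'
  have hπ : (Real.pi : ℂ) ≠ 0 := by exact_mod_cast Real.pi_ne_zero
  have h3 := hne g hg
  have heq : (fun h : G => U (g - h) * A h) = fun h : G => (√(rho k₀ g) : ℂ) / Real.pi
      * ((fun h => coupling k₀ U G g h * f h) ∘ (↑)) h := by
    funext h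
    have h4 := hne h h.2
    simp only [Function.comp_apply, coupling, hg, h.2, and_self, if_true, hf h h.2]
    field_simp
  rw [heq]
  exact h1.mul_left _

theorem normOn_eq_norm (hm : 0 < m) (hG : ∀ g ∈ G, m ≤ rho k₀ g) {f : L2 DualLattice}
    {A : DualLattice → ℂ} (hf : ∀ g ∈ G, f g = √(rho k₀ g) * A g) (hf0 : ∀ g, g ∉ G → f g = 0) :
    normOn k₀ G A = ‖f‖ := by
  have h1 := hasSum_norm_sq f
  have h2 : Function.support (fun g => ‖f g‖ ^ 2) ⊆ G := fun g hg => by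
    by_contra hc
    exact hg (by simp [hf0 g hc])
  rw [← hasSum_subtype_iff_of_support_subset h2] at h1
  have h3 : (fun g : G => rho k₀ g * ‖A g‖ ^ 2) = (fun g => ‖f g‖ ^ 2) ∘ (↑) := by
    funext g
    simp only [Function.comp_apply, hf g g.2]
    rw [norm_mul, mul_pow, Complex.norm_real, Real.norm_of_nonneg (Real.sqrt_nonneg _),
      Real.sq_sqrt (hm.le.trans (hG g g.2))]
  rw [normOn, h3, h1.tsum_eq, Real.sqrt_sq (norm_nonneg _)]

theorem MemHilbert.exists_l2 (hm : 0 < m) (hG : ∀ g ∈ G, m ≤ rho k₀ g) {A : DualLattice → ℂ}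
    (hA : MemHilbert k₀ G A) : ∃ f : L2 DualLattice, ∀ g, f g = √(rho k₀ g) * A g := by
  refine ⟨⟨fun g => √(rho k₀ g) * A g, memℓp_two_iff.2 ?_⟩, fun g => rfl⟩
  have h2 : Function.support (fun g => ‖(√(rho k₀ g) : ℂ) * A g‖ ^ 2) ⊆ G := fun g hg => by
    by_contra hc
    exact hg (by simp [hA.eq_zero g hc])
  have h3 : Summable ((fun g => ‖(√(rho k₀ g) : ℂ) * A g‖ ^ 2) ∘ ((↑) : G → DualLattice)) := by
    refine hA.summable_rho.congr fun g => ?_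
    simp only [Function.comp_apply]
    rw [norm_mul, mul_pow, Complex.norm_real, Real.norm_of_nonneg (Real.sqrt_nonneg _),
      Real.sq_sqrt (hm.le.trans (hG g g.2))]
  exact ((hasSum_subtype_iff_of_support_subset h2).1 h3.hasSum).summable

theorem IsSolution.exists_isTrajectory (hm : 0 < m) (hG : ∀ g ∈ G, m ≤ rho k₀ g)
    (hB : IsCoupling k₀ U G B) {ψ : ℝ → DualLattice → ℂ} (hψ : IsSolution k₀ U G ψ) :
    ∃ φ, IsTrajectory (symbol k₀) B φ ∧ ∀ z g, φ z g = √(rho k₀ g) * ψ z g := by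
  choose φ hφ using fun z => (hψ.mem z).exists_l2 hm hG
  refine ⟨φ, ⟨continuous_iff_continuousAt.2 fun z₀ => ?_, fun g z => ?_⟩, hφ⟩
  · refine tendsto_iff_norm_sub_tendsto_zero.2 ?_
    refine (hψ.continuous z₀).congr fun z => normOn_eq_norm hm hG (fun g _ => ?_) fun g hg => ?_
    · simp [hφ, mul_sub]
    · simp [hφ, (hψ.mem z).eq_zero g hg, (hψ.mem z₀).eq_zero g hg]
  · by_cases hg : g ∈ G
    · have hρ : 0 < rho k₀ g := hm.trans_le (hG g hg)
      have h1 := (hψ.differentiable g hg z).hasDerivAt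
      have h2 := hψ.equation g hg z
      rw [(hB.hasSum_subtype hm hG (fun g _ => hφ z g) hg).tsum_eq] at h2
      simp only [hφ]
      refine (h1.const_mul _).congr_deriv ?_
      simp only [lp.coeFn_smul, Pi.smul_apply, smul_eq_mul, symbol]
      push_cast at h2 ⊢
      have hπ : (Real.pi : ℂ) ≠ 0 := by exact_mod_cast Real.pi_ne_zero
      have hs : (√(rho k₀ g) : ℂ) ≠ 0 := by exact_mod_cast (Real.sqrt_pos.2 hρ).ne'
      have hs2 : (√(rho k₀ g) : ℂ) ^ 2 = rho k₀ g := by exact_mod_cast Real.sq_sqrt hρ.le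
      set s : ℂ := (√(rho k₀ g) : ℂ)
      rw [← hs2] at h2 ⊢
      have h3 : s * deriv (fun ζ => ψ ζ g) z
          = -(Real.pi * Complex.I / s)
            * (Complex.I * (s ^ 2 / Real.pi) * deriv (fun ζ => ψ ζ g) z) := by
        field_simp
        linear_combination deriv (fun ζ => ψ ζ g) z * Complex.I_sq
      rw [h3, eq_sub_of_add_eq h2]
      field_simp
      ring
    -- Off G everything vanishes, so the value of `symbol` there, even where ρ_g = 0, is immaterial.
    · have h0 : ∀ z, φ z g = 0 := fun z => by simp [hφ, (hψ.mem z).eq_zero g hg]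
      simp only [h0]
      refine (hasDerivAt_const z (0 : ℂ)).congr_deriv ?_
      simp only [lp.coeFn_smul, Pi.smul_apply, hB.apply_of_notMem hg]
      simp

theorem IsTrajectory.exists_isSolution (hm : 0 < m) (hG : ∀ g ∈ G, m ≤ rho k₀ g)
    (h0G : (0 : DualLattice) ∈ G) (hB : IsCoupling k₀ U G B) {φ : ℝ → L2 DualLattice}
    (hφ : IsTrajectory (symbol k₀) B φ) (h0 : ∀ g, φ 0 g = √(rho k₀ g) * delta g) :
    ∃ ψ, IsSolution k₀ U G ψ := by
  -- The cut-off of φ to G is a trajectory with the same initial value, so uniqueness confines φ to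
  -- G.
  have hsupp : ∀ z g, g ∉ G → φ z g = 0 := fun z g hg => by
    have h1 : IsTrajectory (symbol k₀) B fun t => proj G (φ t) :=
      hφ.map_diag fun x => by
        change proj G (B x) = B (proj G x)
        rw [hB.proj_apply, hB.apply_proj]
    have h2 := h1.unique hφ (proj_eq_self fun i hi => by
      have h3 : i ≠ 0 := fun h => hi (h ▸ h0G)
      rw [h0, delta, Pi.single_eq_of_ne h3, mul_zero])
    rw [← congrFun h2 z, proj_apply_of_notMem hg]
  have hs : ∀ g ∈ G, (√(rho k₀ g) : ℂ) ≠ 0 := fun g hg => by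
    exact_mod_cast (Real.sqrt_pos.2 (hm.trans_le (hG g hg))).ne'
  have hs2 : ∀ g ∈ G, (√(rho k₀ g) : ℂ) ^ 2 = rho k₀ g := fun g hg => by
    exact_mod_cast Real.sq_sqrt (hm.le.trans (hG g hg))
  let ψ : ℝ → DualLattice → ℂ := fun z g => φ z g / √(rho k₀ g)
  have hφψ : ∀ z, ∀ g ∈ G, φ z g = √(rho k₀ g) * ψ z g := fun z g hg => by
    simp only [ψ]
    rw [mul_div_cancel₀ _ (hs g hg)]
  have hnorm : ∀ z, ∀ g ∈ G, ‖φ z g‖ ^ 2 = rho k₀ g * ‖ψ z g‖ ^ 2 := fun z g hg => by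
    rw [hφψ z g hg, norm_mul, mul_pow, Complex.norm_real,
      Real.norm_of_nonneg (Real.sqrt_nonneg _), Real.sq_sqrt (hm.le.trans (hG g hg))]
  have hrho : ∀ z, Summable fun g : G => rho k₀ g * ‖ψ z g‖ ^ 2 := fun z =>
    ((hasSum_norm_sq (φ z)).summable.subtype G).congr fun g : G => hnorm z g g.2
  refine ⟨ψ, ⟨fun z => ⟨fun g hg => by simp [ψ, hsupp z g hg], ?_, hrho z⟩, fun z₀ => ?_,
    fun g _ z => ((hφ.hasDerivAt g z).div_const _).differentiableAt, fun g hg z => ?_, ?_⟩⟩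
  · refine Summable.of_nonneg_of_le (fun _ => by positivity) (fun g => ?_)
      ((hrho z).mul_left m⁻¹)
    rw [le_inv_mul_iff₀ hm]
    have := hG g g.2
    gcongr
  · refine (tendsto_iff_norm_sub_tendsto_zero.1 (hφ.continuous.tendsto z₀)).congr fun z =>
      (normOn_eq_norm hm hG (fun g hg => ?_) fun g hg => ?_).symm
    · simp [hφψ _ g hg, mul_sub]
    · simp [hsupp _ g hg]
  · rw [(hB.hasSum_subtype hm hG (hφψ z) hg).tsum_eq]
    have h1 : deriv (fun ζ => ψ ζ g) z = _ := ((hφ.hasDerivAt g z).div_const _).deriv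
    rw [h1]
    have hπ : (Real.pi : ℂ) ≠ 0 := by exact_mod_cast Real.pi_ne_zero
    have h2 := hs g hg
    have h3 := hs2 g hg
    simp only [lp.coeFn_smul, Pi.smul_apply, smul_eq_mul, symbol, ψ]
    push_cast
    set s : ℂ := (√(rho k₀ g) : ℂ)
    rw [← h3]
    field_simp
    linear_combination (Real.pi * sigma k₀ g * φ z g + B (φ z) g * s ^ 2) * Complex.I_sq
  · funext g
    by_cases hg : g ∈ G
    · simp only [ψ]
      rw [h0, mul_div_cancel_left₀ _ (hs g hg)]
    · have h3 : g ≠ 0 := fun h => hg (h ▸ h0G)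
      simp [ψ, hsupp 0 g hg, delta, h3]

theorem exists_l2_delta (k₀ : E3) :
    ∃ f : L2 DualLattice, ∀ g, f g = √(rho k₀ g) * delta g := by
  refine ⟨lp.single 2 0 (√(rho k₀ 0) : ℂ), fun g => ?_⟩
  by_cases hg : g = 0
  · subst hg
    simp [delta]
  · rw [lp.single_apply_ne _ _ _ hg, delta, Pi.single_eq_of_ne hg, mul_zero]

theorem existsUnique_isSolution (hm : 0 < m) (hG : ∀ g ∈ G, m ≤ rho k₀ g)
    (h0G : (0 : DualLattice) ∈ G) (hB : IsCoupling k₀ U G B) : ∃! ψ, IsSolution k₀ U G ψ := by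
  obtain ⟨x₀, hx₀⟩ := exists_l2_delta k₀
  obtain ⟨φ, hφ, hφ0⟩ := DHW.exists_isTrajectory (symbol k₀) B x₀
  obtain ⟨ψ, hψ⟩ := hφ.exists_isSolution hm hG h0G hB fun g => by rw [hφ0, hx₀]
  refine ⟨ψ, hψ, fun ψ' hψ' => ?_⟩
  obtain ⟨φ₁, h₁, e₁⟩ := hψ.exists_isTrajectory hm hG hB
  obtain ⟨φ₂, h₂, e₂⟩ := hψ'.exists_isTrajectory hm hG hB
  have h12 : φ₁ = φ₂ := h₁.unique h₂ (by
    ext g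
    rw [e₁, e₂, hψ.initial, hψ'.initial])
  funext z g
  by_cases hg : g ∈ G
  · have h3 : (√(rho k₀ g) : ℂ) ≠ 0 := by
      exact_mod_cast (Real.sqrt_pos.2 (hm.trans_le (hG g hg))).ne'
    have h4 := e₂ z g
    rw [← h12, e₁] at h4
    exact (mul_left_cancel₀ h3 h4).symm
  · rw [(hψ.mem z).eq_zero g hg, (hψ'.mem z).eq_zero g hg]

end Symmetrization

end DHW
end

noncomputable section

namespace DHW

open Filter Topology
open scoped InnerProductSpace

/-! ### Weighted estimate for the far modes. -/

section Localization

variable {k₀ : E3} {U : DualLattice → ℂ} {G : Set DualLattice} {m : ℝ}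
  {B : L2 DualLattice →L[ℂ] L2 DualLattice}

/-- Exponential localization: amplitudes that start at the origin need time proportional to `M` to
leave the ball of radius `M`. -/
theorem IsTrajectory.norm_proj_far_le {φ : ℝ → L2 DualLattice} {D : DualLattice → ℝ}
    (hφ : IsTrajectory D B φ) (hm : 0 < m) (hG : ∀ g ∈ G, m ≤ rho k₀ g)
    (hB : IsCoupling k₀ U G B) {a CU M T : ℝ} (ha : 0 < a) (hM : 0 ≤ M)
    (hU : ∀ g, ‖U g‖ ≤ CU * Real.exp (-(2 * a) * ‖waveVector g‖))
    (h0 : ∀ g, g ≠ 0 → φ 0 g = 0) (hT : 0 ≤ T) :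
    ‖proj {g | M < ‖waveVector g‖} (φ T)‖ ≤
      Real.exp (Real.pi / m * (CU * ∑' g, Real.exp (-a * ‖waveVector g‖)) * T - a * M)
        * ‖φ 0‖ := by
  have hπ := Real.pi_pos
  -- Capping at M keeps the weight bounded. Conjugating B by it costs e^{a|g-h|}, half of the decay
  -- rate 2a of U, and leaves a summable kernel; at the origin the weight is 1.
  let w : DualLattice → ℝ := fun g => Real.exp (a * min ‖waveVector g‖ M)
  have hw0 : ∀ g, 0 < w g := fun g => Real.exp_pos _
  have hwdiv : ∀ g h, w g / w h ≤ Real.exp (a * ‖waveVector (g - h)‖) := fun g h => by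
    simp only [w]
    rw [← Real.exp_sub, Real.exp_le_exp, ← mul_sub]
    refine mul_le_mul_of_nonneg_left ?_ ha.le
    have h1 := norm_waveVector_le_add g h
    have h2 := norm_nonneg (waveVector (g - h))
    rcases min_cases ‖waveVector g‖ M with h3 | h3 <;>
      rcases min_cases ‖waveVector h‖ M with h4 | h4 <;> linarith
  have hwM : ∀ g, ‖((w g : ℝ) : ℂ)‖ ≤ Real.exp (a * M) := fun g => by
    rw [Complex.norm_real, Real.norm_of_nonneg (hw0 g).le, Real.exp_le_exp]
    have := min_le_right ‖waveVector g‖ M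
    gcongr
  obtain ⟨Bw, hBw, hBw'⟩ := exists_kernel_operator
    (K := fun g h => (w g / w h : ℝ) * coupling k₀ U G g h)
    (((summable_exp_neg_mul_norm ha).mul_left CU).mul_left (Real.pi / m)) fun g h => by
      rw [norm_mul, Complex.norm_real, Real.norm_of_nonneg (div_pos (hw0 g) (hw0 h)).le]
      have h1 : ‖coupling k₀ U G g h‖
          ≤ Real.pi / m * (CU * Real.exp (-(2 * a) * ‖waveVector (g - h)‖)) :=
        (norm_coupling_le hm hG g h).trans (by have := hU (g - h); gcongr)
      refine (mul_le_mul (hwdiv g h) h1 (norm_nonneg _) (Real.exp_pos _).le).trans (le_of_eq ?_)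
      have h2 : Real.exp (-a * ‖waveVector (g - h)‖) = Real.exp (a * ‖waveVector (g - h)‖)
          * Real.exp (-(2 * a) * ‖waveVector (g - h)‖) := by
        rw [← Real.exp_add]
        congr 1
        ring
      rw [h2]
      ring
  rw [tsum_mul_left, tsum_mul_left] at hBw
  let W := diag (fun g => ((w g : ℝ) : ℂ)) (Real.exp (a * M)) (Real.exp_pos _).le hwM
  have hW : IsTrajectory D Bw fun t => W (φ t) := hφ.map_diag fun x => by
    ext g
    refine HasSum.unique ?_ (hBw' _ g)
    rw [diag_apply]
    have heq : (fun h => ((w g / w h : ℝ) : ℂ) * coupling k₀ U G g h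
        * diag (fun g => ((w g : ℝ) : ℂ)) (Real.exp (a * M)) (Real.exp_pos _).le hwM x h)
        = fun h => (w g : ℂ) * (coupling k₀ U G g h * x h) := by
      funext h
      have h1 : ((w h : ℝ) : ℂ) ≠ 0 := by exact_mod_cast (hw0 h).ne'
      rw [diag_apply]
      push_cast
      field_simp
    rw [heq]
    exact (hB x g).mul_left _
  have hW0 : W (φ 0) = φ 0 := by
    ext g
    by_cases hg : g = 0
    · subst hg
      simp [W, w, waveVector_zero, hM]
    · simp [W, h0 g hg]
  have hgrow := hW.norm_le_exp hT
  rw [hW0] at hgrow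
  have h1 : ‖proj {g | M < ‖waveVector g‖} (φ T)‖ ≤ Real.exp (-(a * M)) * ‖W (φ T)‖ := by
    refine norm_le_of_forall_norm_le (Real.exp_pos _).le fun g => ?_
    by_cases hg : M < ‖waveVector g‖
    · have h2 : w g = Real.exp (a * M) := by
        simp only [w]
        rw [min_eq_right hg.le]
      rw [proj_apply_of_mem (s := {g | M < ‖waveVector g‖}) hg]
      simp only [W, diag_apply]
      rw [norm_mul, h2, Complex.norm_real, Real.norm_of_nonneg (Real.exp_pos _).le, ← mul_assoc,
        ← Real.exp_add, neg_add_cancel, Real.exp_zero, one_mul]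
    · rw [proj_apply_of_notMem (s := {g | M < ‖waveVector g‖}) hg, norm_zero]
      positivity
  refine h1.trans ?_
  rw [sub_eq_neg_add, Real.exp_add, mul_assoc]
  refine mul_le_mul_of_nonneg_left (hgrow.trans ?_) (Real.exp_pos _).le
  gcongr

end Localization

/-! ### Spectral gap around the row and the resulting error bounds. -/

section SystematicRow

variable {k₀ : E3} {c : ℝ}

theorem norm_le_of_mem_Gsyrow {g : DualLattice} (hg : g ∈ Gsyrow k₀) :
    g 0 = 0 ∧ g 2 = 0 ∧ ‖waveVector g‖ ≤ ‖k₀‖ ^ (1 / 4 : ℝ) := by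
  obtain ⟨n, rfl, hn⟩ := hg
  refine ⟨rfl, rfl, ?_⟩
  refine le_trans (le_of_sq_le_sq ?_ (abs_nonneg (n : ℝ))) hn
  rw [norm_waveVector_sq, sq_abs]
  simp

theorem zero_mem_Gsyrow (k₀ : E3) : (0 : DualLattice) ∈ Gsyrow k₀ :=
  ⟨0, by ext i; fin_cases i <;> rfl, by simp; positivity⟩

theorem ne_zero_of_notMem_Gsyrow {g : DualLattice} (hg : g ∉ Gsyrow k₀)
    (hle : ‖waveVector g‖ ≤ ‖k₀‖ ^ (1 / 4 : ℝ)) : g 0 ≠ 0 ∨ g 2 ≠ 0 := by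
  by_contra! h
  refine hg ⟨g 1, ?_, (abs_le_norm_waveVector g 1).trans hle⟩
  ext i
  fin_cases i
  exacts [h.1, rfl, h.2]

theorem one_le_abs_intCast {n : ℤ} (hn : n ≠ 0) : 1 ≤ |(n : ℝ)| := by
  exact_mod_cast Int.one_le_abs hn

/-- The row is separated from its neighbourhood by a spectral gap. -/
theorem le_abs_sigma {κ q r : ℝ} (hc : 0 < c) (hr : 0 ≤ r) (hk0 : k₀ 0 = c * r) (hk1 : k₀ 1 = 0)
    (hk2 : κ / 2 ≤ k₀ 2) (hκ : 0 ≤ κ) (h1 : 2 * (c * r) * q + q ^ 2 + c * r ≤ κ)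
    (h2 : q ^ 2 ≤ c * r) {g : DualLattice} (hg : g 0 ≠ 0 ∨ g 2 ≠ 0) (hgq : ‖waveVector g‖ ≤ q) :
    c * r ≤ |sigma k₀ g| := by
  have hcr : 0 ≤ c * r := by positivity
  have hsq : ‖waveVector g‖ ^ 2 ≤ q ^ 2 := by gcongr
  have hsq0 := sq_nonneg ‖waveVector g‖
  have hx : |(g 0 : ℝ)| ≤ q := (abs_le_norm_waveVector g 0).trans hgq
  rw [sigma_eq, abs_neg, hk0, hk1]
  -- With g_2 = 0, the term 2cr|g_0| ≥ 2cr beats |g|² ≤ cr; otherwise 2k_z|g_2| ≥ κ exceeds all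
  -- other terms by at least cr.
  by_cases hg2 : g 2 = 0
  · have hg0 : 1 ≤ |(g 0 : ℝ)| := one_le_abs_intCast (hg.resolve_right fun h => h hg2)
    rw [hg2]
    have h3 : |2 * (c * r * g 0 + 0 * g 1 + k₀ 2 * ((0 : ℤ) : ℝ))| = 2 * (c * r) * |(g 0 : ℝ)| := by
      rw [Int.cast_zero, mul_zero, zero_mul, add_zero, add_zero, abs_mul, abs_mul,
        abs_of_nonneg hcr, abs_two]
      ring
    have h4 := abs_sub_abs_le_abs_add (2 * (c * r * g 0 + 0 * g 1 + k₀ 2 * ((0 : ℤ) : ℝ)))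
      (‖waveVector g‖ ^ 2)
    rw [h3, abs_of_nonneg hsq0] at h4
    nlinarith
  · have hg2' : 1 ≤ |(g 2 : ℝ)| := one_le_abs_intCast hg2
    have h3 : |k₀ 2 * (g 2 : ℝ)| = k₀ 2 * |(g 2 : ℝ)| := by
      rw [abs_mul, abs_of_nonneg (by linarith)]
    have h4 : |c * r * (g 0 : ℝ)| = c * r * |(g 0 : ℝ)| := by
      rw [abs_mul, abs_of_nonneg hcr]
    have h5 : c * r * |(g 0 : ℝ)| ≤ c * r * q := by gcongr
    have h6 : κ / 2 ≤ k₀ 2 * |(g 2 : ℝ)| := by nlinarith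
    rw [← h3] at h6
    rw [← h4] at h5
    rcases abs_cases (k₀ 2 * (g 2 : ℝ)) with h7 | h7 <;>
      rcases abs_cases (c * r * (g 0 : ℝ)) with h8 | h8 <;>
      rw [le_abs] <;> first | (left; linarith) | (right; linarith)

/-- A priori bounds for the systematic-row approximation. -/
theorem row_error_bounds {U : DualLattice → ℂ} {a CU r : ℝ} (ha : 0 < a) (hCU : 0 < CU)
    (hc : 0 < c) (hr : 0 ≤ r) (hκ : 0 < ‖k₀‖)
    (hk0 : k₀ 0 = c * r) (hk1 : k₀ 1 = 0) (hk2 : ‖k₀‖ / 2 ≤ k₀ 2)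
    (hU : ∀ g, U (-g) = star (U g))
    (hUb : ∀ g, ‖U g‖ ≤ CU * Real.exp (-(2 * a) * ‖waveVector g‖)) {S b q Δ : ℝ}
    (hS : S = ∑' g, Real.exp (-a * ‖waveVector g‖)) (hb : b = Real.pi / (‖k₀‖ / 4) * (CU * S))
    (hq : q = ‖k₀‖ ^ (1 / 4 : ℝ)) (hΔ : Δ = Real.pi * (c * r) / (2 * ‖k₀‖)) :
    (∃! ψ, IsSolution k₀ U (Ggamma k₀ (1 / 2)) ψ) ∧
    (∃! ψ, IsSolution k₀ U (Gsyrow k₀) ψ) ∧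
    ∀ ψγ ψrow : ℝ → DualLattice → ℂ, IsSolution k₀ U (Ggamma k₀ (1 / 2)) ψγ →
      IsSolution k₀ U (Gsyrow k₀) ψrow → ∀ z, 0 ≤ z → ∀ E A,
      E = normOn k₀ (Gsyrow k₀) (ψrow z - ψγ z) → A = normOn k₀ (Ggamma k₀ (1 / 2)) delta →
      E ≤ 2 * A ∧ E ≤ b * A * z ∧
      ∀ ε x, ε = Real.exp (b * z - a * q) * A → x = 2 * b / Δ → 0 < Δ →
        2 * (c * r) * q + q ^ 2 + c * r ≤ ‖k₀‖ → q ^ 2 ≤ c * r → q ≤ ‖k₀‖ / 4 →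
        2 * (2 * Real.pi * q ^ 2 / ‖k₀‖ + 4 * b) ≤ Δ →
        E ≤ b * (x * A + Real.exp (x * b * z) * (x * A + 2 * b * ε * z) + ε) * z := by
  have hπ := Real.pi_pos
  have hm : 0 < ‖k₀‖ / 4 := by positivity
  have hGγ : ∀ g ∈ Ggamma k₀ (1 / 2), ‖k₀‖ / 4 ≤ rho k₀ g := fun g hg => by
    have h1 : 1 / 2 * rho k₀ 0 ≤ rho k₀ g := hg
    rw [rho_eq k₀ 0] at h1
    simp only [Pi.zero_apply, Int.cast_zero, add_zero] at h1
    linarith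
  have hrow : ∀ g ∈ Gsyrow k₀, rho k₀ g = k₀ 2 := fun g hg => by
    rw [rho_eq, (norm_le_of_mem_Gsyrow hg).2.1, Int.cast_zero, add_zero]
  have hGrow : ∀ g ∈ Gsyrow k₀, ‖k₀‖ / 4 ≤ rho k₀ g := fun g hg => by
    rw [hrow g hg]
    linarith
  have hsub : Gsyrow k₀ ⊆ Ggamma k₀ (1 / 2) := fun g hg => by
    change 1 / 2 * rho k₀ 0 ≤ rho k₀ g
    rw [hrow g hg, rho_eq]
    simp only [Pi.zero_apply, Int.cast_zero, add_zero]
    linarith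
  have h0row := zero_mem_Gsyrow k₀
  have hsum := (summable_exp_neg_mul_norm ha).mul_left CU
  -- Half of the decay is given away so that the same S, hence the same b, bounds both B and its
  -- weighted conjugate.
  have hUb' : ∀ g, ‖U g‖ ≤ CU * Real.exp (-a * ‖waveVector g‖) := fun g =>
    (hUb g).trans (by
      have := norm_nonneg (waveVector g)
      gcongr
      linarith)
  obtain ⟨B, hB, hBn⟩ := exists_isCoupling hm hGγ hsum hUb'
  obtain ⟨B', hB', -⟩ := exists_isCoupling hm hGrow hsum hUb'
  rw [tsum_mul_left, ← hS, ← hb] at hBn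
  have hb0 : 0 ≤ b := (norm_nonneg _).trans hBn
  refine ⟨existsUnique_isSolution hm hGγ (hsub h0row) hB,
    existsUnique_isSolution hm hGrow h0row hB', fun ψγ ψrow hγ hr' z hz E A hE hA => ?_⟩
  obtain ⟨φ, hφ, hφψ⟩ := hγ.exists_isTrajectory hm hGγ hB
  obtain ⟨η, hη, hηψ⟩ := hr'.exists_isTrajectory hm hGrow hB'
  have hsymm := hB.symm hU
  have hφ0 : ∀ g, g ≠ 0 → φ 0 g = 0 := fun g hg => by
    rw [hφψ, hγ.initial, delta, Pi.single_eq_of_ne hg, mul_zero]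
  have hAφ : A = ‖φ 0‖ := by
    rw [hA, ← hγ.initial]
    exact normOn_eq_norm hm hGγ (fun g _ => hφψ 0 g) fun g hg => by
      rw [hφψ, (hγ.mem 0).eq_zero g hg, mul_zero]
  have hA0 : 0 ≤ A := hAφ ▸ norm_nonneg _
  have hEφ : E = ‖η z - proj (Gsyrow k₀) (φ z)‖ := by
    rw [hE]
    refine normOn_eq_norm hm hGrow (fun g hg => ?_) fun g hg => ?_
    · simp [proj_apply_of_mem hg, hφψ, hηψ, mul_sub]
    · simp [proj_apply_of_notMem hg, hηψ, (hr'.mem z).eq_zero g hg]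
  have hη0 : η 0 = proj (Gsyrow k₀) (φ 0) := by
    ext g
    by_cases hg : g ∈ Gsyrow k₀
    · rw [proj_apply_of_mem hg, hφψ, hηψ, hγ.initial, hr'.initial]
    · rw [proj_apply_of_notMem hg, hηψ, (hr'.mem 0).eq_zero g hg, mul_zero]
  have hφn : ∀ t, 0 ≤ t → ‖φ t‖ ≤ A := fun t ht => hAφ ▸ hφ.norm_le hsymm ht
  have hcmp : ∀ {m'}, (∀ t ∈ Set.Icc 0 z, ‖φ t - proj (Gsyrow k₀) (φ t)‖ ≤ m') →
      E ≤ b * m' * z := fun h => hEφ ▸ hφ.norm_sub_proj_le hsymm hη (hB.restrict hsub hB') hη0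
        hBn hz h
  refine ⟨?_, hcmp fun t ht => ?_, fun ε x hε hx hΔ0 h1 h2 h3 h4 => hcmp fun t ht => ?_⟩
  · rw [hEφ, two_mul]
    refine (norm_sub_le _ _).trans (add_le_add ?_ ((norm_proj_apply_le _ _).trans (hφn z hz)))
    refine (hη.norm_le (hB'.symm hU) hz).trans ?_
    rw [hη0, hAφ]
    exact norm_proj_apply_le _ _
  · refine le_trans ?_ (hφn t ht.1)
    have h1 := norm_le_of_forall_norm_le (f := φ t - proj (Gsyrow k₀) (φ t)) (g := φ t)
      zero_le_one fun g => by
        by_cases hg : g ∈ Gsyrow k₀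
        · simp [proj_apply_of_mem hg]
        · simp [proj_apply_of_notMem hg]
    simpa using h1
  · let N : Set DualLattice := {g | ‖waveVector g‖ ≤ q ∧ g ∉ Gsyrow k₀}
    have hRN : Disjoint (Gsyrow k₀) N := Set.disjoint_left.2 fun g hg hN => hN.2 hg
    -- The localization radius q is the row's cut-off: the row lies inside the ball, and N is the
    -- rest of the ball.
    have hfar : (Gsyrow k₀ ∪ N)ᶜ = {g | q < ‖waveVector g‖} := by
      ext g
      simp only [N, Set.mem_compl_iff, Set.mem_union, Set.mem_ofPred_eq]
      constructor
      · intro h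
        by_contra hc
        push Not at h hc
        exact h.1 (h.2 hc)
      · rintro h (hg | hg)
        · have := (norm_le_of_mem_Gsyrow hg).2.2
          rw [← hq] at this
          linarith
        · linarith [hg.1]
    have hq0 : 0 ≤ q := hq ▸ by positivity
    have hAε : ∀ t, 0 ≤ t → t ≤ z → ‖proj (Gsyrow k₀ ∪ N)ᶜ (φ t)‖ ≤ ε := fun t ht0 ht => by
      rw [hfar, hε, hAφ]
      refine (hφ.norm_proj_far_le hm hGγ hB ha hq0 hUb hφ0 ht0).trans ?_
      rw [← hS, ← hb]
      gcongr
    have hk2' : k₀ 2 ≤ ‖k₀‖ := (le_abs_self _).trans (PiLp.norm_apply_le k₀ 2)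
    have hnear := hφ.norm_proj_le_of_gap hsymm hBn hRN (d := 2 * Real.pi * q ^ 2 / ‖k₀‖) (Δ := Δ)
      (ε := ε) (T := t) (fun g hg => ?_) (fun g hg => ?_) (by positivity) hΔ0 h4
      (fun g hg => hφ0 g fun h => hg (h ▸ h0row)) ht.1 fun s hs => hAε s hs.1 (hs.2.trans ht.2)
    · rw [sub_proj_eq hRN]
      refine (norm_add_le _ _).trans (add_le_add (hnear.trans ?_) (hAε t ht.1 ht.2))
      have hε0 : 0 ≤ ε := hε ▸ by positivity
      have hx0 : 0 ≤ x := hx ▸ by positivity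
      rw [← hx, ← hAφ]
      have ht0 := ht.1
      have htz := ht.2
      have h9 : 0 ≤ x * A + 2 * b * ε * t := by positivity
      gcongr
    · obtain ⟨hg0, hg2, hgq⟩ := norm_le_of_mem_Gsyrow hg
      rw [← hq] at hgq
      rw [symbol, sigma_eq, hrow g hg, hg0, hg2, hk1]
      have h5 : 0 < k₀ 2 := by linarith
      have h6 : -(2 * (k₀ 0 * ((0 : ℤ) : ℝ) + 0 * g 1 + k₀ 2 * ((0 : ℤ) : ℝ)) + ‖waveVector g‖ ^ 2)
          = -‖waveVector g‖ ^ 2 := by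
        simp
      rw [h6, abs_div, abs_mul, abs_neg, abs_of_pos hπ, abs_of_pos h5,
        abs_of_nonneg (sq_nonneg _)]
      calc Real.pi * ‖waveVector g‖ ^ 2 / k₀ 2 ≤ Real.pi * q ^ 2 / (‖k₀‖ / 2) := by gcongr
        _ = 2 * Real.pi * q ^ 2 / ‖k₀‖ := by field_simp
    · have hg' := ne_zero_of_notMem_Gsyrow hg.2 (hq ▸ hg.1)
      have h5 := le_abs_sigma hc hr hk0 hk1 hk2 hκ.le h1 h2 hg' hg.1
      have h6 := abs_le.1 ((abs_le_norm_waveVector g 2).trans hg.1)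
      have h7 : 0 < rho k₀ g := by
        rw [rho_eq]
        linarith
      have h8 : rho k₀ g ≤ 2 * ‖k₀‖ := by
        rw [rho_eq]
        linarith
      rw [symbol, abs_div, abs_mul, abs_of_pos hπ, abs_of_pos h7, hΔ]
      gcongr

end SystematicRow

end DHW
end

noncomputable section

namespace DHW

open Filter Topology

/-! ### Powers of |k₀| and the choice of constants. -/

section Asymptotics

/-- Meant for s = κ^{1/20}, where q = s⁵ outweighs the growth exponent C₁s⁴. The power 48 in the
proof is 4 + 4 from the prefactor and 40 from κ². -/
theorem exists_forall_exp_decay {a C₁ C₂ : ℝ} (ha : 0 < a) (hC₁ : 0 ≤ C₁) (hC₂ : 0 ≤ C₂) :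
    ∃ s₀ : ℝ, ∀ s, s₀ ≤ s →
      C₁ * s ^ 4 * (1 + C₂ * (C₁ * s ^ 4)) * Real.exp (C₁ * s ^ 4 - a * s ^ 5)
        ≤ 1 / (s ^ 20) ^ 2 := by
  have h1 : Tendsto (fun s : ℝ => C₁ * (1 + C₂ * C₁) * (s ^ 48 * Real.exp (-s))) atTop (𝓝 0) := by
    simpa using (Real.tendsto_pow_mul_exp_neg_atTop_nhds_zero 48).const_mul (C₁ * (1 + C₂ * C₁))
  obtain ⟨s₁, hs₁⟩ := eventually_atTop.1 (h1.eventually (eventually_le_nhds zero_lt_one))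
  refine ⟨max s₁ (max 1 ((C₁ + 1) / a)), fun s hs => ?_⟩
  have hs1 : 1 ≤ s := (le_max_left _ _).trans ((le_max_right _ _).trans hs)
  have hs2 : C₁ + 1 ≤ s * a :=
    (div_le_iff₀ ha).1 ((le_max_right _ _).trans ((le_max_right _ _).trans hs))
  have hs3 := hs₁ s ((le_max_left _ _).trans hs)
  have hs0 : 0 < s := by linarith
  have h4 : s ≤ s ^ 4 := le_self_pow₀ hs1 (by norm_num)
  have hexp : Real.exp (C₁ * s ^ 4 - a * s ^ 5) ≤ Real.exp (-s) := by
    rw [Real.exp_le_exp]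
    have h5 : (C₁ + 1) * s ^ 4 ≤ s * a * s ^ 4 := by gcongr
    nlinarith
  have h5 : 1 + C₂ * (C₁ * s ^ 4) ≤ (1 + C₂ * C₁) * s ^ 4 := by
    have : 1 ≤ s ^ 4 := hs1.trans h4
    nlinarith
  rw [le_div_iff₀ (by positivity)]
  refine le_trans ?_ hs3
  calc C₁ * s ^ 4 * (1 + C₂ * (C₁ * s ^ 4)) * Real.exp (C₁ * s ^ 4 - a * s ^ 5) * (s ^ 20) ^ 2
      ≤ C₁ * s ^ 4 * ((1 + C₂ * C₁) * s ^ 4) * Real.exp (-s) * (s ^ 20) ^ 2 := by gcongr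
    _ = C₁ * (1 + C₂ * C₁) * (s ^ 48 * Real.exp (-s)) := by ring

/-- Combination of the a priori bounds, with `p = |k₀|^{1/12}`. -/
theorem error_le_of_bounds {p c S CU z A E a b x ε Δ β C₂ : ℝ} (hp : 1 ≤ p) (hc : 0 < c)
    (hS : 0 ≤ S) (hCU : 0 < CU) (hz : 0 ≤ z) (hA : 0 ≤ A)
    (hb : b = Real.pi / (p ^ 12 / 4) * (CU * S)) (hΔ : Δ = Real.pi * (c * p ^ 8) / (2 * p ^ 12))
    (hx : x = 2 * b / Δ) (hε : ε = Real.exp (b * z - a * p ^ 3) * A)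
    (hC₂ : C₂ = 64 * Real.pi * S ^ 2 / c) (hβ : b * z ≤ β)
    (hdecay : β * (1 + 2 * Real.exp C₂ * β) * Real.exp (β - a * p ^ 3) ≤ 1 / (p ^ 12) ^ 2)
    (h1 : E ≤ 2 * A) (h2 : E ≤ b * A * z)
    (h3 : CU ≤ p ^ 6 → E ≤ b * (x * A + Real.exp (x * b * z) * (x * A + 2 * b * ε * z) + ε) * z) :
    E ≤ A * ((2 + 4 * Real.pi * S + (1 + Real.exp C₂) * C₂) * (CU ^ 2 * z / p ^ 18)
      + 1 / (p ^ 12) ^ 2) := by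
  have hπ := Real.pi_pos
  have hp0 : 0 < p := by linarith
  set y := CU ^ 2 * z / p ^ 18 with hy
  have hy0 : 0 ≤ y := by positivity
  have hC0 : 0 ≤ C₂ := hC₂ ▸ by positivity
  have hb0 : 0 ≤ b := hb ▸ by positivity
  have hlast : 0 ≤ 1 / (p ^ 12) ^ 2 := by positivity
  have hπS : 0 ≤ 4 * Real.pi * S := by positivity
  have hexp0 : 0 ≤ (1 + Real.exp C₂) * C₂ := by positivity
  have hbig : ∀ k, E ≤ A * (k * y + 1 / (p ^ 12) ^ 2) →
      k ≤ 2 + 4 * Real.pi * S + (1 + Real.exp C₂) * C₂ →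
      E ≤ A * ((2 + 4 * Real.pi * S + (1 + Real.exp C₂) * C₂) * y + 1 / (p ^ 12) ^ 2) :=
    fun k hE hk => hE.trans (by gcongr)
  -- Three regimes: y ≥ 1, where E ≤ 2A suffices; C_U ≥ κ^{1/2}, where E ≤ bAz does, as C_U/κ ≤
  -- C_U²/κ^{3/2}; and the rest, where the gap bound applies and y ≤ 1 keeps e^{xbz} below e^{C₂}.
  rcases le_total 1 y with hy1 | hy1
  · refine hbig 2 (h1.trans ?_) (by linarith)
    rw [mul_comm]
    gcongr
    linarith
  rcases le_total (p ^ 6) CU with hCp | hCp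
  · refine hbig (4 * Real.pi * S) (h2.trans ?_) (by linarith)
    have h4 : b * z ≤ 4 * Real.pi * S * y := by
      have h5 : CU / p ^ 12 ≤ CU ^ 2 / p ^ 18 := by
        rw [div_le_div_iff₀ (by positivity) (by positivity)]
        calc CU * p ^ 18 = CU * p ^ 12 * p ^ 6 := by ring
          _ ≤ CU * p ^ 12 * CU := by gcongr
          _ = _ := by ring
      calc b * z = 4 * Real.pi * S * z * (CU / p ^ 12) := by
            rw [hb]
            field_simp
        _ ≤ 4 * Real.pi * S * z * (CU ^ 2 / p ^ 18) := by gcongr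
        _ = _ := by
            rw [hy]
            ring
    calc b * A * z = A * (b * z) := by ring
      _ ≤ A * (4 * Real.pi * S * y + 1 / (p ^ 12) ^ 2) := by
        gcongr
        linarith
  · refine hbig ((1 + Real.exp C₂) * C₂) ((h3 hCp).trans ?_) (by linarith)
    have hΔ0 : 0 < Δ := hΔ ▸ by positivity
    have hx0 : 0 ≤ x := hx ▸ by positivity
    have h4 : x * b * z ≤ C₂ * y := by
      have h5 : CU ^ 2 / p ^ 20 ≤ CU ^ 2 / p ^ 18 := by
        gcongr
        norm_num
      calc x * b * z = C₂ * z * (CU ^ 2 / p ^ 20) := by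
            rw [hx, hb, hΔ, hC₂]
            field_simp
            ring
        _ ≤ C₂ * z * (CU ^ 2 / p ^ 18) := by gcongr
        _ = _ := by
            rw [hy]
            ring
    have h5 : x * b * z ≤ C₂ := h4.trans (mul_le_of_le_one_right hC0 hy1)
    have hbz : 0 ≤ b * z := by positivity
    have hβ0 : 0 ≤ β := hbz.trans hβ
    have h6 : b * z * (1 + 2 * Real.exp C₂ * (b * z)) * Real.exp (b * z - a * p ^ 3)
        ≤ 1 / (p ^ 12) ^ 2 := le_trans (by gcongr) hdecay
    calc b * (x * A + Real.exp (x * b * z) * (x * A + 2 * b * ε * z) + ε) * z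
        = A * (x * b * z * (1 + Real.exp (x * b * z)) + b * z *
            (1 + 2 * Real.exp (x * b * z) * (b * z)) * Real.exp (b * z - a * p ^ 3)) := by
          rw [hε]
          ring
      _ ≤ A * (C₂ * y * (1 + Real.exp C₂) + b * z * (1 + 2 * Real.exp C₂ * (b * z))
            * Real.exp (b * z - a * p ^ 3)) := by gcongr
      _ ≤ A * ((1 + Real.exp C₂) * C₂ * y + 1 / (p ^ 12) ^ 2) := by
          rw [mul_comm (C₂ * y), ← mul_assoc (1 + Real.exp C₂)]
          gcongr

/-- Numerical conditions for the spectral gap, with `p = |k₀|^{1/12}`. -/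
theorem gap_conditions {c S p : ℝ} (hc : 0 < c) (hS : 0 ≤ S)
    (h : 4 + 3 * c + (9 + 64 * S) / c ≤ p) :
    1 ≤ p ∧ (9 + 64 * S) * p ^ 6 ≤ c * p ^ 8 ∧ (p ^ 3) ^ 2 ≤ c * p ^ 8 ∧
      2 * (c * p ^ 8) * p ^ 3 + (p ^ 3) ^ 2 + c * p ^ 8 ≤ p ^ 12 ∧ p ^ 3 ≤ p ^ 12 / 4 ∧
      c * p ^ 8 ≤ p ^ 12 / 2 := by
  have hdiv0 : 0 ≤ (9 + 64 * S) / c := by positivity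
  have hp4 : 4 ≤ p := by linarith
  have hp1 : 1 ≤ p := by linarith
  have hp0 : 0 < p := by linarith
  have hpc : 3 * c + 1 ≤ p := by linarith
  have hpS : (9 + 64 * S) * p ^ 6 ≤ c * p ^ 8 := by
    have h1 : 9 + 64 * S ≤ p * c := (div_le_iff₀ hc).1 (by linarith)
    have h2 : p * c ≤ p ^ 2 * c := by
      gcongr
      exact le_self_pow₀ hp1 (by norm_num)
    calc (9 + 64 * S) * p ^ 6 ≤ p ^ 2 * c * p ^ 6 := by
          gcongr
          linarith
      _ = c * p ^ 8 := by ring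
  have hgap : 2 * (c * p ^ 8) * p ^ 3 + (p ^ 3) ^ 2 + c * p ^ 8 ≤ p ^ 12 := by
    have h1 : p ^ 6 ≤ p ^ 11 := pow_le_pow_right₀ hp1 (by norm_num)
    have h2 : c * p ^ 8 ≤ c * p ^ 11 := by
      gcongr
      norm_num
    calc 2 * (c * p ^ 8) * p ^ 3 + (p ^ 3) ^ 2 + c * p ^ 8
        = 2 * c * p ^ 11 + p ^ 6 + c * p ^ 8 := by ring
      _ ≤ (3 * c + 1) * p ^ 11 := by linarith
      _ ≤ p * p ^ 11 := by gcongr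
      _ = p ^ 12 := by ring
  refine ⟨hp1, hpS, ?_, hgap, ?_, ?_⟩
  · have h1 : 0 ≤ (8 + 64 * S) * p ^ 6 := by positivity
    linarith
  · have h1 : 4 * p ^ 3 ≤ p * p ^ 3 := by gcongr
    have h2 : p ^ 4 ≤ p ^ 12 := pow_le_pow_right₀ hp1 (by norm_num)
    linarith
  · have h1 : 1 ≤ p ^ 3 := one_le_pow₀ hp1
    have h2 : c * p ^ 8 * 1 ≤ c * p ^ 8 * p ^ 3 := by gcongr
    have h3 : 0 ≤ (p ^ 3) ^ 2 := by positivity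
    have h4 : 0 ≤ c * p ^ 8 := by positivity
    linarith

theorem half_norm_le {k₀ : E3} {x : ℝ} (hk0 : k₀ 0 = x) (hk1 : k₀ 1 = 0) (hk2 : 0 < k₀ 2)
    (hx : 0 ≤ x) (hle : x ≤ ‖k₀‖ / 2) : ‖k₀‖ / 2 ≤ k₀ 2 := by
  have h1 : ‖k₀‖ ^ 2 = k₀ 0 ^ 2 + k₀ 1 ^ 2 + k₀ 2 ^ 2 := by
    rw [EuclideanSpace.norm_sq_eq, Fin.sum_univ_three]
    simp
  rw [hk0, hk1] at h1
  have h2 : x ^ 2 ≤ (‖k₀‖ / 2) ^ 2 := by gcongr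
  refine le_of_sq_le_sq ?_ hk2.le
  have h3 := sq_nonneg ‖k₀‖
  linarith

end Asymptotics

end DHW
end

/-! ### Assembly of the estimates. -/

theorem theorem4p3 (c αU αstar : ℝ) (hc : 0 < c) (hαU : 0 < αU) (hαstar : 0 < αstar) (N₀ : ℝ) :
    ∃ kstar N₁ : ℝ, 0 < kstar ∧ 0 < N₁ ∧
      ∀ (k₀ : DHW.E3) (CU : ℝ) (U : DHW.DualLattice → ℂ),
        k₀ 0 = c * ‖k₀‖ ^ (2 / 3 : ℝ) → k₀ 1 = 0 → 0 < k₀ 2 → kstar ≤ ‖k₀‖ →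
        0 < CU →
        (∀ g, U (-g) = star (U g)) →
        (∀ g, ‖U g‖ ≤ CU * Real.exp (-αU * ‖DHW.waveVector g‖)) →
        (∃! ψ, DHW.IsSolution k₀ U (DHW.Ggamma k₀ (1 / 2)) ψ) ∧
        (∃! ψ, DHW.IsSolution k₀ U (DHW.Gsyrow k₀) ψ) ∧
        ∀ ψγ ψrow : ℝ → DHW.DualLattice → ℂ,
          DHW.IsSolution k₀ U (DHW.Ggamma k₀ (1 / 2)) ψγ →
          DHW.IsSolution k₀ U (DHW.Gsyrow k₀) ψrow →
          ∀ zstar : ℝ, zstar ≤ N₀ * (αstar * ‖k₀‖) ^ (1 / 5 : ℝ) * (‖k₀‖ / CU) →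
            ∀ z ∈ Set.Icc 0 zstar,
              DHW.normOn k₀ (DHW.Gsyrow k₀) (ψrow z - ψγ z) ≤
                N₁ * (1 / (αstar * ‖k₀‖) ^ 2
                      + αstar ^ (3 / 2 : ℝ) * CU ^ 2 / ‖k₀‖ ^ (3 / 2 : ℝ) * zstar)
                  * DHW.normOn k₀ (DHW.Ggamma k₀ (1 / 2)) DHW.delta := by
  have hπ := Real.pi_pos
  set a : ℝ := αU / 2 with ha_def
  have ha : 0 < a := by positivity
  set S : ℝ := ∑' g, Real.exp (-a * ‖DHW.waveVector g‖) with hS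
  have hS0 : 0 ≤ S := tsum_nonneg fun g => (Real.exp_pos _).le
  set C₂ : ℝ := 64 * Real.pi * S ^ 2 / c with hC₂
  -- Chosen so that bz ≤ C₁κ^{1/5}: the C_U in b cancels the one in the bound on z_*.
  set C₁ : ℝ := 4 * Real.pi * S * (|N₀| * αstar ^ (1 / 5 : ℝ)) with hC₁
  have hC₁0 : 0 ≤ C₁ := by positivity
  set C₃ : ℝ := 2 + 4 * Real.pi * S + (1 + Real.exp C₂) * C₂ with hC₃
  have hC₃0 : 0 < C₃ := by positivity
  obtain ⟨s₀, hs₀⟩ := DHW.exists_forall_exp_decay (C₂ := 2 * Real.exp C₂) ha hC₁0 (by positivity)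
  set p₀ : ℝ := 4 + 3 * c + (9 + 64 * S) / c with hp₀
  have hp₀0 : 0 < p₀ := by positivity
  -- The threshold forces κ^{1/12} ≥ p₀ and κ^{1/20} ≥ s₀. The two summands of N₁ restore the powers
  -- of α_* in the two error terms.
  refine ⟨max (p₀ ^ 12) (max s₀ 0 ^ 20), αstar ^ 2 + C₃ / αstar ^ (3 / 2 : ℝ),
    lt_max_of_lt_left (by positivity), by positivity,
    fun k₀ CU U hk0 hk1 hk2 hk hCU hU hUb => ?_⟩
  set κ : ℝ := ‖k₀‖ with hκ
  have hκ0 : 0 < κ := (by positivity : 0 < p₀ ^ 12).trans_le ((le_max_left _ _).trans hk)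
  have hpow : ∀ (x : ℝ) (n : ℕ), (κ ^ x) ^ n = κ ^ (x * n) := fun x n => by
    rw [Real.rpow_mul hκ0.le, Real.rpow_natCast]
  set p : ℝ := κ ^ (1 / 12 : ℝ) with hp
  have hp12 : p ^ 12 = κ := by rw [hp, hpow]; norm_num
  have hp3 : κ ^ (1 / 4 : ℝ) = p ^ 3 := by rw [hp, hpow]; norm_num
  have hp8 : κ ^ (2 / 3 : ℝ) = p ^ 8 := by rw [hp, hpow]; norm_num
  have hp18 : κ ^ (3 / 2 : ℝ) = p ^ 18 := by rw [hp, hpow]; norm_num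
  have hp0 : 0 < p := by positivity
  have hple : p₀ ≤ p := by
    refine le_of_pow_le_pow_left₀ (n := 12) (by norm_num) hp0.le ?_
    rw [hp12]
    exact (le_max_left _ _).trans hk
  set s : ℝ := κ ^ (1 / 20 : ℝ) with hs
  have hs20 : s ^ 20 = κ := by rw [hs, hpow]; norm_num
  have hs4 : κ ^ (1 / 5 : ℝ) = s ^ 4 := by rw [hs, hpow]; norm_num
  have hs5 : p ^ 3 = s ^ 5 := by rw [hp, hs, hpow, hpow]; norm_num
  have hsle : s₀ ≤ s := (le_max_left s₀ 0).trans (by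
    refine le_of_pow_le_pow_left₀ (n := 20) (by norm_num) (by positivity) ?_
    rw [hs20]
    exact (le_max_right _ _).trans hk)
  obtain ⟨hp1, hpS, hq2, hgap, hqκ, hcr⟩ := DHW.gap_conditions hc hS0 hple
  rw [hp8] at hk0
  have hkz : κ / 2 ≤ k₀ 2 := DHW.half_norm_le hk0 hk1 hk2 (by positivity)
    (by rw [← hκ, ← hp12]; exact hcr)
  obtain ⟨hex, hex', hbound⟩ := DHW.row_error_bounds ha hCU hc (by positivity : 0 ≤ p ^ 8) hκ0 hk0
    hk1 hkz hU (fun g => by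
      have := hUb g
      rwa [ha_def, mul_div_cancel₀ _ two_ne_zero]) hS rfl rfl rfl
  refine ⟨hex, hex', fun ψγ ψrow hγ hrow zstar hzstar z hz => ?_⟩
  obtain ⟨E, hE⟩ : ∃ E, E = DHW.normOn k₀ (DHW.Gsyrow k₀) (ψrow z - ψγ z) := ⟨_, rfl⟩
  obtain ⟨A, hA⟩ : ∃ A, A = DHW.normOn k₀ (DHW.Ggamma k₀ (1 / 2)) DHW.delta := ⟨_, rfl⟩
  obtain ⟨h1, h2, h3⟩ := hbound ψγ ψrow hγ hrow z hz.1 E A hE hA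
  rw [← hE, ← hA]
  have h3' := h3 _ _ rfl rfl
  rw [← hκ, hp3, ← hp12] at h3'
  rw [← hκ, ← hp12] at h2
  have hA0 : 0 ≤ A := hA ▸ Real.sqrt_nonneg _
  set b : ℝ := Real.pi / (p ^ 12 / 4) * (CU * S) with hb
  have hbz : b * z ≤ C₁ * s ^ 4 := by
    have h4 : z ≤ |N₀| * αstar ^ (1 / 5 : ℝ) * s ^ 4 * (κ / CU) := by
      refine (hz.2.trans hzstar).trans ?_
      rw [Real.mul_rpow hαstar.le hκ0.le, hs4, ← mul_assoc]
      gcongr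
      exact le_abs_self _
    have hb0 : 0 ≤ b := by positivity
    calc b * z ≤ b * (|N₀| * αstar ^ (1 / 5 : ℝ) * s ^ 4 * (κ / CU)) := by gcongr
      _ = C₁ * s ^ 4 := by
        rw [hb, hp12, hC₁]
        field_simp
  have hdecay := hs₀ s hsle
  rw [hs20, ← hp12, ← hs5] at hdecay
  have hmain := DHW.error_le_of_bounds hp1 hc hS0 hCU hz.1 hA0 hb rfl rfl rfl hC₂ hbz hdecay h1 h2
    fun hCp => h3' (by positivity) hgap hq2 hqκ (by
      -- Only here is C_U ≤ κ^{1/2} needed: it makes b = O(κ^{-1/2}), small against the gap of order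
      -- κ^{-1/3}.
      have h4 : b ≤ 4 * Real.pi * S * p ^ 6 / p ^ 12 := by
        calc b = 4 * Real.pi * S * CU / p ^ 12 := by
              rw [hb]
              field_simp
          _ ≤ _ := by gcongr
      calc 2 * (2 * Real.pi * (p ^ 3) ^ 2 / p ^ 12 + 4 * b)
          ≤ 2 * (2 * Real.pi * (p ^ 3) ^ 2 / p ^ 12 + 4 * (4 * Real.pi * S * p ^ 6 / p ^ 12)) := by
            gcongr
        _ = Real.pi * ((8 + 64 * S) * p ^ 6) / (2 * p ^ 12) := by
            field_simp
            ring
        _ ≤ Real.pi * (c * p ^ 8) / (2 * p ^ 12) := by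
            have h6 : 0 ≤ p ^ 6 := by positivity
            have h7 : (8 + 64 * S) * p ^ 6 ≤ c * p ^ 8 := by linarith
            gcongr Real.pi * ?_ / _)
  rw [← hC₃, hp12] at hmain
  refine hmain.trans ?_
  rw [mul_comm A]
  refine mul_le_mul_of_nonneg_right ?_ hA0
  rw [hp18]
  have hα : 0 < αstar ^ (3 / 2 : ℝ) := by positivity
  have hzz : z ≤ zstar := hz.2
  have hz0 : 0 ≤ zstar := hz.1.trans hz.2
  calc C₃ * (CU ^ 2 * z / p ^ 18) + 1 / κ ^ 2
      ≤ C₃ * (CU ^ 2 * zstar / p ^ 18) + 1 / κ ^ 2 := by gcongr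
    _ = αstar ^ 2 * (1 / (αstar * κ) ^ 2) + C₃ / αstar ^ (3 / 2 : ℝ)
          * (αstar ^ (3 / 2 : ℝ) * CU ^ 2 / p ^ 18 * zstar) := by
        field_simp
        ring
    _ ≤ (αstar ^ 2 + C₃ / αstar ^ (3 / 2 : ℝ)) * (1 / (αstar * κ) ^ 2)
          + (αstar ^ 2 + C₃ / αstar ^ (3 / 2 : ℝ))
          * (αstar ^ (3 / 2 : ℝ) * CU ^ 2 / p ^ 18 * zstar) := by
        gcongr
        · exact le_add_of_nonneg_right (by positivity)
        · exact le_add_of_nonneg_left (by positivity)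
    _ = _ := by ring
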